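/- Let $\Sigma$ be an alphabet (a finite non-empty set) and let $w\ge 1$ be an integer. A $(\Sigma,w)$-layer is a tuple $B=(\ell,r,T,I,F,\iota,\phi)$ with $\ell,r\subseteq\{0,\dots,w-1\}$ (left and right states), $T\subseteq \ell\times\Sigma\times r$, $I\subseteq\ell$, $F\subseteq r$ and $\iota,\phi\in\{0,1\}$, such that $\iota=0$ implies $I=\emptyset$ and $\phi=0$ implies $F=\emptyset$. The layer is deterministic if $\iota=1$ implies $I=\ell$ and $|\ell|=1$, and for all $p\in\ell$, $a\in\Sigma$ there is at most one $q$ with $(p,a,q)\in T$. It is complete if $\iota=1$ implies $I\neq\emptyset$, and for all $p\in\ell$, $a\in\Sigma$ there is at least one $q$ with $(p,a,q)\in T$. A $(\Sigma,w)$-ODD of length $k\ge 1$ is a string $D=B_1\cdots B_k$ of $(\Sigma,w)$-layers with $\ell(B_{i+1})=r(B_i)$ for $1\le i<k$, with $\iota(B_i)=1$ exactly for $i=1$, and with $\phi(B_i)=1$ exactly for $i=k$. It is deterministic (complete) if all of its layers are. Its language is the length-typed set $\mathcal L(D)=(k,L)$, where $L\subseteq\Sigma^k$ is the set of all strings $a_1\cdots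 a_k$ for which there are states $q_0,\dots,q_k$ with $q_0\in I(B_1)$, $q_k\in F(B_k)$ and $(q_{i-1},a_i,q_i)\in T(B_i)$ for $1\le i\le k$. A $(\Sigma,w)$-SOFA (second-order finite automaton) is a (nondeterministic) finite automaton $\mathcal F$ over the alphabet of all $(\Sigma,w)$-layers such that every string accepted by $\mathcal F$ is a $(\Sigma,w)$-ODD. Its second language is $\mathcal L_2(\mathcal F)=\{\mathcal L(D) : D \text{ is accepted by } \mathcal F\}$. Let $\mathcal D(\Sigma,w)$ be the set of all $\mathcal L(D)$ with $D$ a deterministic, complete $(\Sigma,w)$-ODD. Theorem. Let $\mathcal F,\mathcal F_1,\mathcal F_2$ be $(\Sigma,w)$-SOFAs. 1. There is a $(\Sigma,2^w)$-SOFA with second language $\mathcal L_2(\mathcal F_1)\cap\mathcal L_2(\mathcal F_2)$. 2. There is a $(\Sigma,2^w)$-SOFA with second language $\mathcal L_2(\mathcal F_1)\cup\mathcal L_2(\mathcal F_2)$. 3. There is a $(\Sigma,2^w)$-SOFA with second language $\mathcal L_2(\mathcal F_1)\setminus\mathcal L_2(\mathcal F_2)$. 4. There is a $(\Sigma,w)$-SOFA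 with second language $\mathcal D(\Sigma,w)$. 5. For every integer $w'\ge 1$ there is a $(\Sigma,2^{\max\{w,w'\}})$-SOFA with second language $\mathcal D(\Sigma,w')\setminus\mathcal L_2(\mathcal F)$. Moreover, for the alphabets $\Sigma=\{0,\dots,n-1\}$, $n\ge 1$, the automata in 1-5 can be computed: for each of the five items there is a computable function which, given $n$, $w$, (in item 5) $w'$, and explicit finite descriptions of the given SOFAs, outputs an explicit finite description of an automaton as claimed. Finally, the following problems are decidable, each by one algorithm that receives $n$, $w$ and explicit finite descriptions of $(\{0,\dots,n-1\},w)$-SOFAs $\mathcal F_1,\mathcal F_2$ as input: 6. whether $\mathcal L_2(\mathcal F_1)\cap\mathcal L_2(\mathcal F_2)=\emptyset$; 7. whether $\mathcal L_2(\mathcal F_1)\subseteq\mathcal L_2(\mathcal F_2)$. -/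

import Mathlib

namespace SOFA

/-- An `(A, w)`-layer. The states of a layer are elements of `Fin w = {0, …, w - 1}`. -/
@[ext]
structure Layer (A : Type*) (w : ℕ) where
  left : Finset (Fin w)
  right : Finset (Fin w)
  trans : Finset (Fin w × A × Fin w)
  init : Finset (Fin w)
  final : Finset (Fin w)
  initFlag : Bool
  finalFlag : Bool
  trans_mem : ∀ t ∈ trans, t.1 ∈ left ∧ t.2.2 ∈ right
  init_subset : init ⊆ left
  final_subset : final ⊆ right
  init_eq_empty : initFlag = false → init = ∅
  final_eq_empty : finalFlag = false → final = ∅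

section

variable {A : Type*} {w : ℕ}

/-- Deterministic layers. -/
def Layer.Deterministic (l : Layer A w) : Prop :=
  (l.initFlag = true → l.init = l.left ∧ l.left.card = 1) ∧
    ∀ p ∈ l.left, ∀ a : A, ∀ q ∈ l.right, ∀ q' ∈ l.right,
      (p, a, q) ∈ l.trans → (p, a, q') ∈ l.trans → q = q'

/-- Complete layers. -/
def Layer.Complete (l : Layer A w) : Prop :=
  (l.initFlag = true → l.init.Nonempty) ∧
    ∀ p ∈ l.left, ∀ a : A, ∃ q ∈ l.right, (p, a, q) ∈ l.trans

/-- A non-empty string of layers is an ordered decision diagram if consecutive frontiers agree,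
exactly the first layer carries the initial flag, and exactly the last one the final flag. -/
def IsODD (D : List (Layer A w)) : Prop :=
  D ≠ [] ∧
  D.IsChain (fun l l' => l'.left = l.right) ∧
  (∀ l ∈ D.head?, l.initFlag = true) ∧ (∀ l ∈ D.tail, l.initFlag = false) ∧
  (∀ l ∈ D.getLast?, l.finalFlag = true) ∧ (∀ l ∈ D.dropLast, l.finalFlag = false)

/-- `t` is an accepting sequence of transitions for the string `s` in `D`: the labels of `t` spell
`s`, consecutive transitions fit together, the `i`-th transition lies in the `i`-th layer, the
first state is initial and the last state is final. -/
def IsAcceptingSeq (D : List (Layer A w)) (s : List A) (t : List (Fin w × A × Fin w)) : Prop :=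
  t.map (fun x => x.2.1) = s ∧
  t.IsChain (fun x y => y.1 = x.2.2) ∧
  List.Forall₂ (fun x l => x ∈ l.trans) t D ∧
  (∀ x ∈ t.head?, ∀ l ∈ D.head?, x.1 ∈ l.init) ∧
  (∀ x ∈ t.getLast?, ∀ l ∈ D.getLast?, x.2.2 ∈ l.final)

/-- The length-typed language `(k, L)` of an ordered decision diagram of length `k`. Every accepted
string has length `k`, so `L ⊆ A ^ k`. -/
def oddLang (D : List (Layer A w)) : ℕ × Set (List A) :=
  (D.length, {s | ∃ t, IsAcceptingSeq D s t})

/-- A finite automaton over the alphabet of `(A, w)`-layers is an `(A, w)`-second-order finite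
automaton if all strings that it accepts are ordered decision diagrams. (Finiteness of the set of
states is required where this is used.) -/
def IsSOFA {σ : Type*} (F : NFA (Layer A w) σ) : Prop :=
  ∀ D ∈ F.accepts, IsODD D

/-- The second language of an automaton over the alphabet of layers. -/
def secondLang {σ : Type*} (F : NFA (Layer A w) σ) : Set (ℕ × Set (List A)) :=
  {X | ∃ D ∈ F.accepts, oddLang D = X}

end

/-- The class of all languages of deterministic, complete `(A, w)`-ordered decision diagrams. -/
def detLangs (A : Type*) (w : ℕ) : Set (ℕ × Set (List A)) :=
  {X | ∃ D : List (Layer A w), IsODD D ∧ (∀ l ∈ D, l.Deterministic ∧ l.Complete) ∧ oddLang D = X}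

/-- The width-`w` complement of a class of length-typed languages. -/
def widthCompl {A : Type*} (w : ℕ) (X : Set (ℕ × Set (List A))) : Set (ℕ × Set (List A)) :=
  detLangs A w \ X

/-! ### Finite descriptions, as inputs and outputs of algorithms -/

/-- Codes of layers: lists of left states, right states, transitions, initial states and final
states, and the two flags. -/
abbrev LayerCode : Type :=
  List ℕ × List ℕ × List (ℕ × ℕ × ℕ) × List ℕ × List ℕ × Bool × Bool

/-- Codes of automata over layers: the number `m` of states (the states are `0, …, m - 1`), and
lists of initial states, final states and transitions. -/
abbrev AutCode : Type :=
  ℕ × List ℕ × List ℕ × List (ℕ × LayerCode × ℕ)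

/-- The list `L` enumerates, through the injection `v`, exactly the elements of `S`. -/
def Enumerates {α β : Type*} (v : α → β) (L : List β) (S : Finset α) : Prop :=
  ∀ x, x ∈ L ↔ ∃ y ∈ S, v y = x

/-- `c` is a code of the layer `l` over the alphabet `Fin n`. -/
def LayerCode.Describes {n w : ℕ} (c : LayerCode) (l : Layer (Fin n) w) : Prop :=
  Enumerates Fin.val c.1 l.left ∧
  Enumerates Fin.val c.2.1 l.right ∧
  Enumerates (fun t : Fin w × Fin n × Fin w => ((t.1 : ℕ), (t.2.1 : ℕ), (t.2.2 : ℕ)))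
    c.2.2.1 l.trans ∧
  Enumerates Fin.val c.2.2.2.1 l.init ∧
  Enumerates Fin.val c.2.2.2.2.1 l.final ∧
  c.2.2.2.2.2.1 = l.initFlag ∧
  c.2.2.2.2.2.2 = l.finalFlag

/-- The finite automaton over the alphabet of `(Fin n, w)`-layers that is described by a code.
List entries that are out of range are ignored. -/
def AutCode.toNFA (n w : ℕ) (c : AutCode) : NFA (Layer (Fin n) w) (Fin c.1) where
  step q l := {q' | ∃ d : LayerCode, d.Describes l ∧ ((q : ℕ), d, (q' : ℕ)) ∈ c.2.2.2}
  start := {q | (q : ℕ) ∈ c.2.1}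
  accept := {q | (q : ℕ) ∈ c.2.2.1}

/-- The automaton with code `c` is a `(Fin n, w)`-second-order finite automaton. -/
def AutCode.IsSOFA (n w : ℕ) (c : AutCode) : Prop :=
  SOFA.IsSOFA (c.toNFA n w)

/-- The second language of the automaton with code `c`. -/
def AutCode.secondLang (n w : ℕ) (c : AutCode) : Set (ℕ × Set (List (Fin n))) :=
  SOFA.secondLang (c.toNFA n w)


/-- Every finite set is enumerated by some list. -/
theorem exists_enumerates {α β : Type*} (v : α → β) (S : Finset α) :
    ∃ L : List β, Enumerates v L S :=
  ⟨S.toList.map v, fun x => by simp [List.mem_map]⟩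

/-- Every layer over the alphabet `Fin n` has a code. -/
theorem exists_describes {n w : ℕ} (l : Layer (Fin n) w) :
    ∃ c : LayerCode, c.Describes l := by
  obtain ⟨a, ha⟩ := exists_enumerates Fin.val l.left
  obtain ⟨b, hb⟩ := exists_enumerates Fin.val l.right
  obtain ⟨t, ht⟩ := exists_enumerates
    (fun t : Fin w × Fin n × Fin w => ((t.1 : ℕ), (t.2.1 : ℕ), (t.2.2 : ℕ))) l.trans
  obtain ⟨i, hi⟩ := exists_enumerates Fin.val l.init
  obtain ⟨f, hf⟩ := exists_enumerates Fin.val l.final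
  exact ⟨(a, b, t, i, f, l.initFlag, l.finalFlag), ha, hb, ht, hi, hf, rfl, rfl⟩

/-- A code describes at most one layer. -/
theorem describes_unique {n w : ℕ} {c : LayerCode} {l l' : Layer (Fin n) w}
    (h : c.Describes l) (h' : c.Describes l') : l = l' := by
  have key : ∀ {α β : Type} {v : α → β} (_ : Function.Injective v) {L : List β} {S T : Finset α},
      Enumerates v L S → Enumerates v L T → S = T := by
    intro α β v hv L S T hS hT
    ext y
    have h1 := hS (v y)
    have h2 := hT (v y)
    simp only [hv.eq_iff, exists_eq_right] at h1 h2
    exact h1.symm.trans h2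
  have ht : Function.Injective
      (fun t : Fin w × Fin n × Fin w => ((t.1 : ℕ), (t.2.1 : ℕ), (t.2.2 : ℕ))) := by
    rintro ⟨a, b, c⟩ ⟨a', b', c'⟩ h
    simpa [Fin.ext_iff] using h
  obtain ⟨h1, h2, h3, h4, h5, h6, h7⟩ := h
  obtain ⟨g1, g2, g3, g4, g5, g6, g7⟩ := h'
  exact Layer.ext (key Fin.val_injective h1 g1) (key Fin.val_injective h2 g2) (key ht h3 g3)
    (key Fin.val_injective h4 g4) (key Fin.val_injective h5 g5) (h6.symm.trans g6)
    (h7.symm.trans g7)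

/-- Every finite automaton over the alphabet of `(Fin n, w)`-layers with states `0, …, m - 1` is
described by a code. -/
theorem exists_code {n w m : ℕ} (F : NFA (Layer (Fin n) w) (Fin m)) :
    ∃ S T R, AutCode.toNFA n w (m, S, T, R) = F := by
  classical
  have hfin : Finite (Layer (Fin n) w) := by
    refine Finite.of_injective (β := Finset (Fin w) × Finset (Fin w) ×
      Finset (Fin w × Fin n × Fin w) × Finset (Fin w) × Finset (Fin w) × Bool × Bool)
      (fun l => (l.left, l.right, l.trans, l.init, l.final, l.initFlag, l.finalFlag)) ?_
    intro l l' h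
    simp only [Prod.mk.injEq] at h
    exact Layer.ext h.1 h.2.1 h.2.2.1 h.2.2.2.1 h.2.2.2.2.1 h.2.2.2.2.2.1 h.2.2.2.2.2.2
  choose c hc using fun l : Layer (Fin n) w => exists_describes l
  have hR : {x : Fin m × Layer (Fin n) w × Fin m | x.2.2 ∈ F.step x.1 x.2.1}.Finite :=
    Set.toFinite _
  refine ⟨((Set.toFinite F.start).toFinset.toList.map Fin.val),
    ((Set.toFinite F.accept).toFinset.toList.map Fin.val),
    (hR.toFinset.toList.map fun x => ((x.1 : ℕ), c x.2.1, (x.2.2 : ℕ))), ?_⟩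
  obtain ⟨step, start, accept⟩ := F
  simp only [AutCode.toNFA, NFA.mk.injEq]
  refine ⟨?_, ?_, ?_⟩
  · funext q l
    ext q'
    simp only [Set.mem_ofPred_eq, List.mem_map, Finset.mem_toList, Set.Finite.mem_toFinset,
      Prod.mk.injEq]
    constructor
    · rintro ⟨d, hd, ⟨p, a, p'⟩, hp, h1, h2, h3⟩
      obtain rfl : p = q := Fin.ext h1
      obtain rfl : p' = q' := Fin.ext h3
      subst h2
      obtain rfl := describes_unique hd (hc a)
      exact hp
    · intro h
      exact ⟨c l, hc l, (q, l, q'), h, rfl, rfl, rfl⟩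
  · ext q
    simp [Fin.val_inj]
  · ext q
    simp [Fin.val_inj]

end SOFA

/-! The difficulty is that one length-typed language has many decision diagrams, so Boolean
operations on second languages are not Boolean operations on sets of diagrams. The remedy is to
saturate: replace a regular set `K` of diagrams by `simClosure W K`, all strings of width-`W` layers
that accept the same words as some member of `K`. Among ODDs, lying in this closure depends only on
the language (`sim_iff`, `mem_simClosure_accepts`), so Boolean operations become the usual ones.

The closure is again regular (`RegLe.simClosure`). An automaton reading `D'` guesses `D` layer by
layer and stores the set of all pairs of subset-construction states that `D` and `D'` reach on a
common word. Only finitely many such sets exist; it accepts if all final pairs agree on acceptance.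
Being an ODD is regular too, so `boolComb` is regular, with an explicit state bound. A language from
either class has a width-`W` diagram as soon as `W` is at least both widths, by embedding the states
(`sim_widen`); hence `secondLang_boolComb`. For the bound `2 ^ w` only `w ≤ 2 ^ w` matters.

For computability no automaton construction is transferred to codes. It suffices to have a primitive
recursive membership test and a computable bound on the number of states. By `RegLe.exists_short`,
both emptiness and equivalence with a candidate automaton are then decided by testing finitely many
words, and a correct code is found by enumerating all codes (`exists_computable_code`). Disjointness
and inclusion are emptiness tests for an intersection and a difference. -/

namespace SOFA

/-! ### Regular languages with a bound on the number of states -/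

/-- `L` is accepted by a deterministic automaton with at most `N` states. -/
def RegLe {α : Type*} (L : Language α) (N : ℕ) : Prop :=
  ∃ k ≤ N, ∃ M : DFA α (Fin k), M.accepts = L

section

variable {α : Type*}

theorem RegLe.mono {L : Language α} {N N' : ℕ} (h : RegLe L N) (hN : N ≤ N') : RegLe L N' := by
  obtain ⟨k, hk, M, hM⟩ := h
  exact ⟨k, hk.trans hN, M, hM⟩

theorem RegLe.of_dfa {σ : Type*} [Finite σ] (M : DFA α σ) : RegLe M.accepts (Nat.card σ) :=
  ⟨_, le_rfl, DFA.reindex (Finite.equivFin σ) M, DFA.accepts_reindex _ _⟩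

theorem natCard_set (σ : Type*) [Finite σ] : Nat.card (Set σ) = 2 ^ Nat.card σ := by
  have := Fintype.ofFinite σ
  rw [Nat.card_eq_fintype_card, Nat.card_eq_fintype_card, Fintype.card_set]

/-- Lets inductions over nondeterministic runs proceed from a single state. -/
theorem mem_acceptsFrom_iff_exists {σ : Type*} (F : NFA α σ) (S : Set σ) (x : List α) :
    x ∈ F.acceptsFrom S ↔ ∃ s ∈ S, x ∈ F.acceptsFrom {s} := by
  simp only [NFA.mem_acceptsFrom]
  constructor
  · rintro ⟨t, ht, h⟩
    obtain ⟨s, hs, h'⟩ := NFA.mem_evalFrom_iff_exists.mp h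
    exact ⟨s, hs, t, ht, h'⟩
  · rintro ⟨s, hs, t, ht, h⟩
    exact ⟨t, ht, NFA.mem_evalFrom_iff_exists.mpr ⟨s, hs, h⟩⟩

theorem RegLe.of_nfa {σ : Type*} [Finite σ] (F : NFA α σ) : RegLe F.accepts (2 ^ Nat.card σ) := by
  have h := RegLe.of_dfa F.toDFA
  rwa [NFA.toDFA_correct, natCard_set] at h

/-- Product automaton. As both factors are deterministic, the pair of states reached decides both
memberships, so any condition `p` can serve as acceptance. -/
theorem RegLe.op {L₁ L₂ : Language α} {N₁ N₂ : ℕ} (h₁ : RegLe L₁ N₁) (h₂ : RegLe L₂ N₂)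
    (p : Prop → Prop → Prop) : RegLe ({x | p (x ∈ L₁) (x ∈ L₂)} : Set (List α)) (N₁ * N₂) := by
  obtain ⟨k₁, hk₁, M₁, rfl⟩ := h₁
  obtain ⟨k₂, hk₂, M₂, rfl⟩ := h₂
  let M : DFA α (Fin k₁ × Fin k₂) :=
    { step := fun s a => (M₁.step s.1 a, M₂.step s.2 a)
      start := (M₁.start, M₂.start)
      accept := {s | p (s.1 ∈ M₁.accept) (s.2 ∈ M₂.accept)} }
  have hM : ∀ (x : List α) (s : Fin k₁ × Fin k₂),
      M.evalFrom s x = (M₁.evalFrom s.1 x, M₂.evalFrom s.2 x) := by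
    intro x
    induction x with
    | nil => intro s; rfl
    | cons a x ih => intro s; simp only [DFA.evalFrom_cons, ih]; rfl
  have h := RegLe.of_dfa M
  rw [Nat.card_prod, Nat.card_fin, Nat.card_fin] at h
  have hacc : M.accepts = ({x | p (x ∈ M₁.accepts) (x ∈ M₂.accepts)} : Set (List α)) := by
    ext x
    change M.evalFrom _ x ∈ M.accept ↔ _
    rw [hM]
    rfl
  rw [← hacc]
  exact h.mono (Nat.mul_le_mul hk₁ hk₂)

/-- A non-empty language with an automaton with `N` states has a word shorter than `N`. -/
theorem RegLe.exists_short {L : Language α} {N : ℕ} (h : RegLe L N) (hL : ∃ x, x ∈ L) :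
    ∃ x ∈ L, x.length < N := by
  classical
  obtain ⟨k, hk, M, rfl⟩ := h
  have hex : ∃ m, ∃ x ∈ M.accepts, x.length = m := by
    obtain ⟨x, hx⟩ := hL
    exact ⟨_, x, hx, rfl⟩
  obtain ⟨x, hx, hlen⟩ := Nat.find_spec hex
  refine ⟨x, hx, ?_⟩
  by_contra hc
  -- Pumping: a shortest accepted word with at least `k` letters would repeat a state, and cutting
  -- out the loop `b` leaves a shorter accepted word.
  obtain ⟨q, a, b, c, rfl, -, hb, h1, h2, h3⟩ :=
    M.evalFrom_split (x := x) (s := M.start) (t := M.evalFrom M.start x)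
      (by rw [Fintype.card_fin]; omega) rfl
  refine Nat.find_min hex (m := (a ++ c).length) ?_ ⟨a ++ c, ?_, rfl⟩
  · rw [← hlen]
    have := List.length_pos_iff.mpr hb
    simp only [List.length_append]
    omega
  · rw [DFA.mem_accepts] at hx ⊢
    change M.evalFrom _ _ ∈ _ at hx
    change M.evalFrom _ _ ∈ _
    rw [DFA.evalFrom_of_append, h1, h3]
    exact hx

theorem RegLe.exists_nfa {L : Language α} {N : ℕ} (h : RegLe L N) :
    ∃ (m : ℕ) (G : NFA α (Fin m)), G.accepts = L := by
  obtain ⟨k, -, M, rfl⟩ := h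
  exact ⟨k, M.toNFA, M.toNFA_correct⟩

end

/-! ### Runs of decision diagrams -/

section

variable {A : Type*} {w W : ℕ}

/-- One step of the subset simulation of a decision diagram. A state is the set of states reached
so far, together with the information whether a final state of the last layer was reached. -/
def runStep (p : Set (Fin w) × Prop) (x : Layer A w × A) : Set (Fin w) × Prop :=
  ({q | ∃ r, (r ∈ p.1 ∨ r ∈ x.1.init) ∧ (r, x.2, q) ∈ x.1.trans},
    ∃ q ∈ x.1.final, ∃ r, (r ∈ p.1 ∨ r ∈ x.1.init) ∧ (r, x.2, q) ∈ x.1.trans)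

/-- `zip` truncates to the shorter list, so the value is only meaningful for equal lengths. The
second component is overwritten at each step; after a nonempty run it speaks of the last layer
alone. -/
def runFrom (p : Set (Fin w) × Prop) (D : List (Layer A w)) (s : List A) : Set (Fin w) × Prop :=
  (D.zip s).foldl runStep p

/-- Two strings of layers have the same length and accept the same strings in the subset
simulation. -/
def Sim (D : List (Layer A w)) (D' : List (Layer A W)) : Prop :=
  D.length = D'.length ∧ ∀ s : List A, s.length = D.length →
    ((runFrom (∅, False) D s).2 ↔ (runFrom (∅, False) D' s).2)

/-- The strings of layers that simulate a member of `K`. -/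
def simClosure (W : ℕ) (K : Set (List (Layer A w))) : Set (List (Layer A W)) :=
  {D' | ∃ D ∈ K, Sim D D'}

/-- The pairs of states that are reached from a pair in `R` by reading one symbol. -/
def pairStep (R : Set ((Set (Fin w) × Prop) × (Set (Fin W) × Prop))) (l : Layer A w)
    (l' : Layer A W) : Set ((Set (Fin w) × Prop) × (Set (Fin W) × Prop)) :=
  {x | ∃ p ∈ R, ∃ a : A, (runStep p.1 (l, a), runStep p.2 (l', a)) = x}

/-- Nondeterminism guesses the layers `l` of the simulated diagram, while the second component
follows all words at once. The guess is thus made before any word is chosen, which gives the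
quantifier order ∃ `D`, ∀ `s`. The state set is finite whatever the alphabet `A` is. -/
def simNFA {k : ℕ} (M : DFA (Layer A w) (Fin k)) : NFA (Layer A W)
    (Fin k × Set ((Set (Fin w) × Prop) × (Set (Fin W) × Prop))) where
  step s l' := {t | ∃ l, (M.step s.1 l, pairStep s.2 l l') = t}
  start := {(M.start, {((∅, False), (∅, False))})}
  accept := {s | s.1 ∈ M.accept ∧ ∀ p ∈ s.2, (p.1.2 ↔ p.2.2)}

/-- An arbitrary set `R` of pairs is needed for the induction: reading a layer replaces `R` by its
successors under every letter, which absorbs the first letter of `s`. -/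
theorem mem_simNFA_acceptsFrom {k : ℕ} (M : DFA (Layer A w) (Fin k)) (D' : List (Layer A W)) :
    ∀ q R, D' ∈ (simNFA M).acceptsFrom {(q, R)} ↔ ∃ D, D.length = D'.length ∧
      M.evalFrom q D ∈ M.accept ∧ ∀ s : List A, s.length = D.length → ∀ p ∈ R,
        ((runFrom p.1 D s).2 ↔ (runFrom p.2 D' s).2) := by
  induction D' with
  | nil =>
    intro q R
    rw [NFA.nil_mem_acceptsFrom]
    simp [simNFA, runFrom]
  | cons l' D' ih =>
    intro q R
    have hstep : ∀ t, t ∈ (simNFA M).stepSet {(q, R)} l' ↔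
        ∃ l, (M.step q l, pairStep R l l') = t := by
      intro t
      rw [NFA.stepSet_singleton]
      rfl
    rw [NFA.cons_mem_acceptsFrom, mem_acceptsFrom_iff_exists]
    simp only [hstep, exists_exists_eq_and]
    simp only [ih]
    constructor
    · rintro ⟨l, D, hlen, hacc, h⟩
      refine ⟨l :: D, by simp [hlen], hacc, ?_⟩
      rintro (_ | ⟨a, s⟩) hs p hp
      · simp at hs
      · exact h s (by simpa using hs) _ ⟨p, hp, a, rfl⟩
    · rintro ⟨_ | ⟨l, D⟩, hlen, hacc, h⟩
      · simp at hlen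
      · refine ⟨l, D, by simpa using hlen, hacc, ?_⟩
        rintro s hs _ ⟨p, hp, a, rfl⟩
        exact h (a :: s) (by simpa using hs) p hp

theorem simNFA_accepts {k : ℕ} (M : DFA (Layer A w) (Fin k)) :
    (simNFA M).accepts = simClosure W M.accepts := by
  ext D'
  rw [NFA.accepts_eq_acceptsFrom_start]
  refine (mem_simNFA_acceptsFrom M D' M.start {((∅, False), (∅, False))}).trans ?_
  simp only [Set.mem_singleton_iff, forall_eq]
  constructor
  · rintro ⟨D, h1, h2, h3⟩
    exact ⟨D, h2, h1, h3⟩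
  · rintro ⟨D, h2, h1, h3⟩
    exact ⟨D, h1, h2, h3⟩

/-- There are `2 ^ w * 2` subset states on one side and `2 ^ W * 2` on the other; the inner power
counts sets of pairs, the outer one comes from determinization. -/
theorem RegLe.simClosure {K : Language (Layer A w)} {N : ℕ} (h : RegLe K N) (W : ℕ) :
    RegLe (SOFA.simClosure W K) (2 ^ (N * 2 ^ (2 ^ w * 2 * (2 ^ W * 2)))) := by
  obtain ⟨k, hk, M, rfl⟩ := h
  rw [← simNFA_accepts]
  refine (RegLe.of_nfa _).mono ?_
  have hP : Nat.card Prop = 2 := by simp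
  simp only [Nat.card_prod, natCard_set, Nat.card_fin, hP]
  gcongr
  norm_num

/-! ### The automaton that recognizes decision diagrams -/

/-- States: whether a layer was read, whether no violation was found, the right states of the last
layer, and the final flag of the last layer. -/
def oddStep (P : Layer A w → Prop) (s : Prop × Prop × Finset (Fin w) × Prop) (l : Layer A w) :
    Prop × Prop × Finset (Fin w) × Prop :=
  (True, s.2.1 ∧ P l ∧ (s.1 ∧ l.initFlag = false ∧ ¬ s.2.2.2 ∧ l.left = s.2.2.1 ∨
      ¬ s.1 ∧ l.initFlag = true), l.right, l.finalFlag = true)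

def oddDFA (P : Layer A w → Prop) : DFA (Layer A w) (Prop × Prop × Finset (Fin w) × Prop) where
  step := oddStep P
  -- The frontier and the final flag are placeholders: while the first component is `False`, the
  -- transition does not look at them.
  start := (False, True, ∅, False)
  accept := {s | s.1 ∧ s.2.1 ∧ s.2.2.2}

/-- All that matters about the past, once `l` has been read, is `ok`, the frontier and the final
flag of `l`; keeping `l` at the head of the list expresses the remaining conditions. -/
theorem oddDFA_evalFrom (P : Layer A w → Prop) (l : Layer A w) (D : List (Layer A w)) :
    ∀ (ok : Prop), (oddDFA P).evalFrom (True, ok, l.right, l.finalFlag = true) D ∈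
        (oddDFA P).accept ↔ ok ∧ (∀ x ∈ D, P x) ∧
      (l :: D).IsChain (fun l l' => l'.left = l.right) ∧ (∀ x ∈ D, x.initFlag = false) ∧
      (∀ x ∈ (l :: D).getLast?, x.finalFlag = true) ∧
      (∀ x ∈ (l :: D).dropLast, x.finalFlag = false) := by
  induction D generalizing l with
  | nil => intro ok; simp [oddDFA]
  | cons l' D ih =>
    intro ok
    rw [DFA.evalFrom_cons]
    refine (ih l' _).trans ?_
    simp only [List.forall_mem_cons, List.isChain_cons_cons, List.getLast?_cons_cons,
      List.dropLast_cons_cons, not_true_eq_false, false_and, or_false, true_and,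
      Bool.not_eq_true]
    tauto

theorem oddDFA_accepts (P : Layer A w → Prop) :
    (oddDFA P).accepts = ({D | IsODD D ∧ ∀ l ∈ D, P l} : Set (List (Layer A w))) := by
  ext D
  cases D with
  | nil =>
    change _ ∈ (oddDFA P).accept ↔ _ ∧ _
    simp [IsODD, oddDFA]
  | cons l D =>
    change (oddDFA P).evalFrom _ _ ∈ (oddDFA P).accept ↔ _ ∧ _
    rw [DFA.evalFrom_cons]
    refine (oddDFA_evalFrom P l D _).trans ?_
    simp only [List.forall_mem_cons, IsODD, List.head?_cons, List.tail_cons, Option.mem_def,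
      Option.some.injEq, forall_eq', oddDFA]
    simp only [ne_eq, reduceCtorEq, not_false_eq_true, true_and, false_and, false_or]
    tauto

theorem RegLe.isODD (P : Layer A w → Prop) :
    RegLe ({D | IsODD D ∧ ∀ l ∈ D, P l} : Set (List (Layer A w))) (2 * (2 * (2 ^ w * 2))) := by
  rw [← oddDFA_accepts]
  refine (RegLe.of_dfa _).mono (le_of_eq ?_)
  have hP : Nat.card Prop = 2 := by simp
  have hF : Nat.card (Finset (Fin w)) = 2 ^ w := by simp
  simp only [Nat.card_prod, hP, hF]

end

/-! ### The language of a decision diagram through runs -/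

section

variable {A : Type*} {w W : ℕ}

/-- `runStep` admits initial states at every layer. Emptiness of `init` after the first layer keeps
runs from starting in the middle. The flag `b` is irrelevant since at least one layer is read. -/
theorem run_final_iff (D : List (Layer A w)) : ∀ (l : Layer A w) (a : A) (s : List A)
    (S : Set (Fin w)) (b : Prop), (∀ x ∈ D, x.init = ∅) → s.length = D.length →
    ((runFrom (S, b) (l :: D) (a :: s)).2 ↔ ∃ x t, (x :: t).map (fun x => x.2.1) = a :: s ∧
      (x :: t).IsChain (fun x y => y.1 = x.2.2) ∧
      List.Forall₂ (fun x l => x ∈ l.trans) (x :: t) (l :: D) ∧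
      (x.1 ∈ S ∨ x.1 ∈ l.init) ∧
      (∀ y ∈ (x :: t).getLast?, ∀ k ∈ (l :: D).getLast?, y.2.2 ∈ k.final)) := by
  induction D with
  | nil =>
    intro l a s S b _ hs
    obtain rfl : s = [] := by simpa using hs
    simp only [runFrom, List.zip_cons_cons, List.zip_nil_right, List.foldl_cons, List.foldl_nil,
      runStep]
    constructor
    · rintro ⟨q, hq, r, hr, h⟩
      exact ⟨(r, a, q), [], by simp, by simp, by simpa using h, hr, by simpa using hq⟩
    · rintro ⟨⟨r, a', q⟩, t, h1, h2, h3, h4, h5⟩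
      simp only [List.map_cons, List.cons.injEq, List.map_eq_nil_iff] at h1
      obtain ⟨rfl, rfl⟩ := h1
      exact ⟨q, by simpa using h5, r, h4, by simpa using h3⟩
  | cons l' D ih =>
    intro l a s S b hD hs
    cases s with
    | nil => simp at hs
    | cons a' s =>
      rw [List.forall_mem_cons] at hD
      refine (ih l' a' s _ _ hD.2 (by simpa using hs)).trans ?_
      constructor
      · rintro ⟨x, t, h1, h2, h3, h4, h5⟩
        rw [hD.1] at h4
        obtain ⟨r, hr, h⟩ : ∃ r, (r ∈ S ∨ r ∈ l.init) ∧ (r, a, x.1) ∈ l.trans := by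
          simpa [runStep] using h4
        refine ⟨(r, a, x.1), x :: t, ?_, ?_, ?_, hr, ?_⟩
        · rw [List.map_cons, h1]
        · exact List.isChain_cons_cons.mpr ⟨rfl, h2⟩
        · exact List.Forall₂.cons h h3
        · simpa only [List.getLast?_cons_cons] using h5
      · rintro ⟨⟨r, a'', p⟩, t, h1, h2, h3, h4, h5⟩
        cases t with
        | nil => simp at h1
        | cons x t =>
          rw [List.map_cons, List.cons.injEq] at h1
          obtain ⟨rfl, h1⟩ := h1
          rw [List.isChain_cons_cons] at h2
          rw [List.forall₂_cons] at h3
          have hp : x.1 = p := h2.1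
          refine ⟨x, t, h1, h2.2, h3.2, Or.inl ⟨r, h4, ?_⟩, ?_⟩
          · rw [hp]
            exact h3.1
          · simpa only [List.getLast?_cons_cons] using h5

theorem mem_oddLang_iff {D : List (Layer A w)} (hD : IsODD D) (s : List A) :
    s ∈ (oddLang D).2 ↔ s.length = D.length ∧ (runFrom (∅, False) D s).2 := by
  have hlen : s ∈ (oddLang D).2 → s.length = D.length := by
    rintro ⟨t, rfl, -, h, -⟩
    simpa using h.length_eq
  rw [← and_iff_right_of_imp hlen]
  refine and_congr_right fun hs => ?_
  cases D with
  | nil => exact absurd rfl hD.1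
  | cons l D =>
    cases s with
    | nil => simp at hs
    | cons a s =>
      have hinit : ∀ x ∈ D, x.init = ∅ := fun x hx => x.init_eq_empty (hD.2.2.2.1 x hx)
      rw [run_final_iff D l a s _ _ hinit (by simpa using hs)]
      constructor
      · rintro ⟨t, h1, h2, h3, h4, h5⟩
        cases t with
        | nil => simp at h1
        | cons x t => exact ⟨x, t, h1, h2, h3, Or.inr (by simpa using h4), h5⟩
      · rintro ⟨x, t, h1, h2, h3, h4, h5⟩
        exact ⟨x :: t, h1, h2, h3, by simpa using h4, h5⟩

theorem sim_iff {D : List (Layer A w)} {D' : List (Layer A W)} (hD : IsODD D) (hD' : IsODD D') :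
    Sim D D' ↔ oddLang D = oddLang D' := by
  rw [Prod.ext_iff, Set.ext_iff]
  simp only [mem_oddLang_iff hD, mem_oddLang_iff hD']
  constructor
  · rintro ⟨h1, h2⟩
    refine ⟨h1, fun s => ?_⟩
    rw [← h1]
    exact and_congr_right (h2 s)
  · rintro ⟨h1, h2⟩
    have h1 : D.length = D'.length := h1
    refine ⟨h1, fun s hs => ?_⟩
    have := h2 s
    rw [← h1] at this
    simpa [hs] using this

/-! ### Widening the frontiers -/

def Layer.widen (h : w ≤ W) (l : Layer A w) : Layer A W where
  left := l.left.map (Fin.castLEEmb h)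
  right := l.right.map (Fin.castLEEmb h)
  trans := l.trans.map ((Fin.castLEEmb h).prodMap ((Function.Embedding.refl A).prodMap
    (Fin.castLEEmb h)))
  init := l.init.map (Fin.castLEEmb h)
  final := l.final.map (Fin.castLEEmb h)
  initFlag := l.initFlag
  finalFlag := l.finalFlag
  trans_mem := by
    intro t ht
    obtain ⟨u, hu, rfl⟩ := Finset.mem_map.mp ht
    exact ⟨Finset.mem_map_of_mem _ (l.trans_mem u hu).1,
      Finset.mem_map_of_mem _ (l.trans_mem u hu).2⟩
  init_subset := Finset.map_subset_map.mpr l.init_subset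
  final_subset := Finset.map_subset_map.mpr l.final_subset
  init_eq_empty := fun h' => by rw [l.init_eq_empty h', Finset.map_empty]
  final_eq_empty := fun h' => by rw [l.final_eq_empty h', Finset.map_empty]

/-- No transition of the widened layer leaves or enters the new states, so the run is the image of
the old one, and acceptance is unchanged. -/
theorem runStep_widen (h : w ≤ W) (S : Set (Fin w)) (b : Prop) (l : Layer A w) (a : A) :
    runStep (Fin.castLE h '' S, b) (l.widen h, a) =
      (Fin.castLE h '' (runStep (S, b) (l, a)).1, (runStep (S, b) (l, a)).2) := by
  have htr : ∀ r q, (r, a, q) ∈ (l.widen h).trans ↔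
      ∃ r' q', (r', a, q') ∈ l.trans ∧ Fin.castLE h r' = r ∧ Fin.castLE h q' = q := by
    intro r q
    simp only [Layer.widen, Finset.mem_map, Prod.exists]
    constructor
    · rintro ⟨r', a', q', h1, h2⟩
      simp only [Function.Embedding.prodMap, Function.Embedding.coeFn_mk, Prod.map_apply,
        Prod.mk.injEq] at h2
      obtain ⟨h2, h3, h4⟩ := h2
      obtain rfl : a' = a := h3
      exact ⟨r', q', h1, h2, h4⟩
    · rintro ⟨r', q', h1, rfl, rfl⟩
      exact ⟨r', a, q', h1, rfl⟩
  have hin : ∀ r, (Fin.castLE h r ∈ Fin.castLE h '' S ∨ Fin.castLE h r ∈ (l.widen h).init) ↔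
      (r ∈ S ∨ r ∈ l.init) := by
    intro r
    rw [(Fin.castLE_injective h).mem_set_image]
    simp [Layer.widen]
  refine Prod.ext (Set.ext fun q => ?_) (propext ?_)
  · constructor
    · rintro ⟨r, hr, h1⟩
      obtain ⟨r', q', h2, rfl, rfl⟩ := (htr _ _).mp h1
      exact ⟨q', ⟨r', (hin r').mp hr, h2⟩, rfl⟩
    · rintro ⟨q, ⟨r, hr, h1⟩, rfl⟩
      exact ⟨Fin.castLE h r, (hin r).mpr hr, (htr _ _).mpr ⟨r, q, h1, rfl, rfl⟩⟩
  · constructor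
    · rintro ⟨q, hq, r, hr, h1⟩
      obtain ⟨r', q', h2, rfl, rfl⟩ := (htr _ _).mp h1
      exact ⟨q', by simpa [Layer.widen] using hq, r', (hin r').mp hr, h2⟩
    · rintro ⟨q, hq, r, hr, h1⟩
      exact ⟨Fin.castLE h q, by simpa [Layer.widen] using hq,
        Fin.castLE h r, (hin r).mpr hr, (htr _ _).mpr ⟨r, q, h1, rfl, rfl⟩⟩

theorem runFrom_widen (h : w ≤ W) (D : List (Layer A w)) : ∀ (S : Set (Fin w)) (b : Prop)
    (s : List A), runFrom (Fin.castLE h '' S, b) (D.map (Layer.widen h)) s =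
      (Fin.castLE h '' (runFrom (S, b) D s).1, (runFrom (S, b) D s).2) := by
  induction D with
  | nil => intro S b s; rfl
  | cons l D ih =>
    intro S b s
    cases s with
    | nil => rfl
    | cons a s =>
      have h1 := ih (runStep (S, b) (l, a)).1 (runStep (S, b) (l, a)).2 s
      rw [← runStep_widen] at h1
      exact h1

theorem sim_widen (h : w ≤ W) (D : List (Layer A w)) : Sim D (D.map (Layer.widen h)) := by
  refine ⟨by simp, fun s _ => ?_⟩
  have h1 := runFrom_widen h D ∅ False s
  rw [Set.image_empty] at h1
  rw [h1]

theorem IsODD.widen (h : w ≤ W) {D : List (Layer A w)} (hD : IsODD D) :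
    IsODD (D.map (Layer.widen h)) := by
  obtain ⟨h1, h2, h3, h4, h5, h6⟩ := hD
  refine ⟨by simpa using h1, ?_, ?_, ?_, ?_, ?_⟩
  · rw [List.isChain_map]
    exact h2.imp fun l l' hl => by simp [Layer.widen, hl]
  · rw [List.head?_map]
    intro l hl
    obtain ⟨k, hk, rfl⟩ := Option.mem_map.mp hl
    exact h3 k hk
  · rw [← List.map_tail]
    intro l hl
    obtain ⟨k, hk, rfl⟩ := List.mem_map.mp hl
    exact h4 k hk
  · rw [List.getLast?_map]
    intro l hl
    obtain ⟨k, hk, rfl⟩ := Option.mem_map.mp hl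
    exact h5 k hk
  · rw [← List.map_dropLast]
    intro l hl
    obtain ⟨k, hk, rfl⟩ := List.mem_map.mp hl
    exact h6 k hk

/-! ### Boolean combinations of second languages -/

variable {w₁ w₂ : ℕ}

/-- The decision diagrams of width `W` whose membership in the classes represented by `K₁` and `K₂`
satisfies the Boolean condition `p`. -/
def boolComb (p : Prop → Prop → Prop) (W : ℕ) (K₁ : Set (List (Layer A w₁)))
    (K₂ : Set (List (Layer A w₂))) : Set (List (Layer A W)) :=
  {D | (IsODD D ∧ ∀ l ∈ D, True) ∧ p (D ∈ simClosure W K₁) (D ∈ simClosure W K₂)}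

/-- The factors bound the automata for ODDs and for the two closures. -/
def boolCombBound (W w₁ N₁ w₂ N₂ : ℕ) : ℕ :=
  2 * (2 * (2 ^ W * 2)) * (2 ^ (N₁ * 2 ^ (2 ^ w₁ * 2 * (2 ^ W * 2))) *
    2 ^ (N₂ * 2 ^ (2 ^ w₂ * 2 * (2 ^ W * 2))))

theorem RegLe.boolComb (p : Prop → Prop → Prop) (W : ℕ) {K₁ : Language (Layer A w₁)}
    {K₂ : Language (Layer A w₂)} {N₁ N₂ : ℕ} (h₁ : RegLe K₁ N₁) (h₂ : RegLe K₂ N₂) :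
    RegLe (boolComb p W K₁ K₂) (boolCombBound W w₁ N₁ w₂ N₂) :=
  (RegLe.isODD fun _ => True).op ((h₁.simClosure W).op (h₂.simClosure W) p) And

/-- Stated as an equality of propositions so that it rewrites inside an arbitrary condition `p`. -/
theorem mem_simClosure_accepts {σ : Type*} {F : NFA (Layer A w) σ} (hF : IsSOFA F)
    {D : List (Layer A W)} (hD : IsODD D) :
    (D ∈ simClosure W (F.accepts : Set _)) = (oddLang D ∈ secondLang F) :=
  propext (exists_congr fun E => and_congr_right fun hE => sim_iff (hF E hE) hD)

/-- `¬ p False False` keeps out languages belonging to neither class; these need not have a diagram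
of width `W`. -/
theorem secondLang_boolComb {p : Prop → Prop → Prop} (hp : ¬ p False False) (h₁ : w₁ ≤ W)
    (h₂ : w₂ ≤ W) {σ₁ σ₂ τ : Type*} {F₁ : NFA (Layer A w₁) σ₁} {F₂ : NFA (Layer A w₂) σ₂}
    (hF₁ : IsSOFA F₁) (hF₂ : IsSOFA F₂) {G : NFA (Layer A W) τ}
    (hG : G.accepts = boolComb p W F₁.accepts F₂.accepts) :
    IsSOFA G ∧ secondLang G = {X | p (X ∈ secondLang F₁) (X ∈ secondLang F₂)} := by
  have hmem : ∀ D, D ∈ G.accepts ↔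
      IsODD D ∧ p (oddLang D ∈ secondLang F₁) (oddLang D ∈ secondLang F₂) := by
    intro D
    rw [hG]
    constructor
    · rintro ⟨⟨hD, -⟩, h⟩
      rw [mem_simClosure_accepts hF₁ hD, mem_simClosure_accepts hF₂ hD] at h
      exact ⟨hD, h⟩
    · rintro ⟨hD, h⟩
      rw [← mem_simClosure_accepts hF₁ hD, ← mem_simClosure_accepts hF₂ hD] at h
      exact ⟨⟨hD, fun _ _ => trivial⟩, h⟩
  refine ⟨fun D hD => ((hmem D).mp hD).1, Set.ext fun X => ⟨?_, fun h => ?_⟩⟩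
  · rintro ⟨D, hD, rfl⟩
    exact ((hmem D).mp hD).2
  -- A witness of width `W` is the widening of a diagram from whichever class contains `X`.
  · have hX : ∃ D : List (Layer A W), IsODD D ∧ oddLang D = X := by
      by_cases hX₁ : X ∈ secondLang F₁
      · obtain ⟨D, hD, rfl⟩ := hX₁
        have hw := (hF₁ D hD).widen h₁
        exact ⟨_, hw, ((sim_iff (hF₁ D hD) hw).mp (sim_widen h₁ D)).symm⟩
      · by_cases hX₂ : X ∈ secondLang F₂
        · obtain ⟨D, hD, rfl⟩ := hX₂
          have hw := (hF₂ D hD).widen h₂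
          exact ⟨_, hw, ((sim_iff (hF₂ D hD) hw).mp (sim_widen h₂ D)).symm⟩
        · have h : p (X ∈ secondLang F₁) (X ∈ secondLang F₂) := h
          rw [eq_false hX₁, eq_false hX₂] at h
          exact absurd h hp
    obtain ⟨D, hD, rfl⟩ := hX
    exact ⟨D, (hmem D).mpr ⟨hD, h⟩, rfl⟩

/-- The deterministic, complete decision diagrams. -/
def detODDs (A : Type*) (w : ℕ) : Set (List (Layer A w)) :=
  {D | IsODD D ∧ ∀ l ∈ D, l.Deterministic ∧ l.Complete}

theorem secondLang_detODDs {τ : Type*} {G : NFA (Layer A w) τ} (hG : G.accepts = detODDs A w) :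
    IsSOFA G ∧ secondLang G = detLangs A w := by
  constructor
  · intro D hD
    rw [hG] at hD
    exact hD.1
  · ext X
    rw [secondLang, hG]
    exact exists_congr fun D => and_assoc

end

/-! ### Primitive recursive functions in compositional form -/

-- With these rules, primitive recursiveness of most algorithms below follows by unfolding and
-- `fun_prop`. Functional arguments are uncurried over the pair of parameter and list entry.
attribute [fun_prop] Primrec
attribute [fun_prop] Primrec.id Primrec.const Primrec.comp Primrec.pair

namespace PrimrecComp

variable {α β γ δ : Type*} [Primcodable α] [Primcodable β] [Primcodable γ] [Primcodable δ]

@[fun_prop]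
theorem fst {f : α → β × γ} (hf : Primrec f) : Primrec fun a => (f a).1 := Primrec.fst.comp hf

@[fun_prop]
theorem snd {f : α → β × γ} (hf : Primrec f) : Primrec fun a => (f a).2 := Primrec.snd.comp hf

@[fun_prop]
theorem and {f g : α → Bool} (hf : Primrec f) (hg : Primrec g) : Primrec fun a => (f a && g a) :=
  Primrec.and.comp hf hg

@[fun_prop]
theorem or {f g : α → Bool} (hf : Primrec f) (hg : Primrec g) : Primrec fun a => (f a || g a) :=
  Primrec.or.comp hf hg

@[fun_prop]
theorem not {f : α → Bool} (hf : Primrec f) : Primrec fun a => !(f a) := Primrec.not.comp hf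

@[fun_prop]
theorem beq [DecidableEq β] {f g : α → β} (hf : Primrec f) (hg : Primrec g) :
    Primrec fun a => (f a == g a) := Primrec.beq.comp hf hg

@[fun_prop]
theorem mul {f g : α → ℕ} (hf : Primrec f) (hg : Primrec g) : Primrec fun a => f a * g a :=
  Primrec.nat_mul.comp hf hg

@[fun_prop]
theorem pow {f g : α → ℕ} (hf : Primrec f) (hg : Primrec g) : Primrec fun a => f a ^ g a :=
  (Primrec₂.unpaired'.mp Nat.Primrec.pow : Primrec₂ fun m n : ℕ => m ^ n).comp hf hg

@[fun_prop]
theorem max {f g : α → ℕ} (hf : Primrec f) (hg : Primrec g) : Primrec fun a => max (f a) (g a) :=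
  Primrec.nat_max.comp hf hg

@[fun_prop]
theorem length {f : α → List β} (hf : Primrec f) : Primrec fun a => (f a).length :=
  Primrec.list_length.comp hf

@[fun_prop]
theorem range {f : α → ℕ} (hf : Primrec f) : Primrec fun a => List.range (f a) :=
  Primrec.list_range.comp hf

@[fun_prop]
theorem tail {f : α → List β} (hf : Primrec f) : Primrec fun a => (f a).tail :=
  Primrec.list_tail.comp hf

@[fun_prop]
theorem headI [Inhabited β] {f : α → List β} (hf : Primrec f) : Primrec fun a => (f a).headI :=
  Primrec.list_headI.comp hf

@[fun_prop]
theorem cons {f : α → β} {g : α → List β} (hf : Primrec f) (hg : Primrec g) :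
    Primrec fun a => f a :: g a := Primrec.list_cons.comp hf hg

@[fun_prop]
theorem append {f g : α → List β} (hf : Primrec f) (hg : Primrec g) :
    Primrec fun a => f a ++ g a := Primrec.list_append.comp hf hg

@[fun_prop]
theorem map {f : α → List β} {g : α → β → γ} (hf : Primrec f)
    (hg : Primrec fun x : α × β => g x.1 x.2) : Primrec fun a => (f a).map (g a) :=
  Primrec.list_map hf hg

@[fun_prop]
theorem flatMap {f : α → List β} {g : α → β → List γ} (hf : Primrec f)
    (hg : Primrec fun x : α × β => g x.1 x.2) : Primrec fun a => (f a).flatMap (g a) :=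
  Primrec.list_flatMap hf hg

@[fun_prop]
theorem filter {f : α → List β} {g : α → β → Bool} (hf : Primrec f)
    (hg : Primrec fun x : α × β => g x.1 x.2) : Primrec fun a => (f a).filter (g a) := by
  have h : Primrec fun a => (f a).flatMap fun b => cond (g a b) [b] [] :=
    Primrec.list_flatMap hf (Primrec.cond hg (Primrec.list_cons.comp Primrec.snd
      (Primrec.const [])) (Primrec.const []))
  refine h.of_eq fun a => ?_
  induction f a with
  | nil => rfl
  | cons b l ih => cases hb : g a b <;> simp [hb, ih]

@[fun_prop]
theorem foldl {f : α → List β} {g : α → δ} {h : α → δ → β → δ} (hf : Primrec f) (hg : Primrec g)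
    (hh : Primrec fun x : α × δ × β => h x.1 x.2.1 x.2.2) :
    Primrec fun a => (f a).foldl (h a) (g a) :=
  Primrec.list_foldl (h := fun a x => h a x.1 x.2) hf hg hh

@[fun_prop]
theorem any {f : α → List β} {g : α → β → Bool} (hf : Primrec f)
    (hg : Primrec fun x : α × β => g x.1 x.2) : Primrec fun a => (f a).any (g a) := by
  have h : Primrec fun a => (f a).foldr (fun b s => g a b || s) false :=
    Primrec.list_foldr (h := fun a x => g a x.1 || x.2) hf (Primrec.const false)
      (Primrec.or.comp (hg.comp (Primrec.pair Primrec.fst (Primrec.fst.comp Primrec.snd)))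
        (Primrec.snd.comp Primrec.snd))
  refine h.of_eq fun a => ?_
  induction f a with
  | nil => rfl
  | cons b l ih => simp [ih]

@[fun_prop]
theorem all {f : α → List β} {g : α → β → Bool} (hf : Primrec f)
    (hg : Primrec fun x : α × β => g x.1 x.2) : Primrec fun a => (f a).all (g a) := by
  have h : Primrec fun a => !((f a).any fun b => !(g a b)) := by fun_prop
  exact h.of_eq fun a => by simp [List.not_any_eq_all_not]

@[fun_prop]
theorem contains [DecidableEq β] {f : α → List β} {g : α → β} (hf : Primrec f) (hg : Primrec g) :
    Primrec fun a => (f a).contains (g a) := by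
  have h : Primrec fun a => (f a).any fun b => (g a == b) := by fun_prop
  exact h.of_eq fun a => List.any_beq

end PrimrecComp

/-! ### Finite enumerations -/

section

variable {α β γ : Type*}

/-- The lists of length `k` with entries from `L`. -/
def words (L : List β) : ℕ → List (List β)
  | 0 => [[]]
  | k + 1 => (words L k).flatMap fun t => L.map fun b => b :: t

theorem mem_words (L : List β) (k : ℕ) (t : List β) :
    t ∈ words L k ↔ t.length = k ∧ ∀ b ∈ t, b ∈ L := by
  induction k generalizing t with
  | zero => simp +contextual [words]
  | succ k ih =>
    cases t with
    | nil => simp [words]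
    | cons b t =>
      simp only [words, List.mem_flatMap, List.mem_map, List.cons.injEq, ih, List.length_cons,
        List.forall_mem_cons, Nat.add_right_cancel_iff]
      constructor
      · rintro ⟨_, ⟨h1, h2⟩, _, h3, rfl, rfl⟩
        exact ⟨h1, h3, h2⟩
      · rintro ⟨h1, h3, h2⟩
        exact ⟨t, ⟨h1, h2⟩, b, h3, rfl, rfl⟩

def subLists (L : List β) : List (List β) :=
  L.foldl (fun acc x => acc ++ acc.map fun t => t ++ [x]) [[]]

theorem mem_subLists (L t : List β) : t ∈ subLists L ↔ t.Sublist L := by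
  induction L using List.reverseRecOn generalizing t with
  | nil => simp [subLists]
  | append_singleton L x ih =>
    have h : subLists (L ++ [x]) = subLists L ++ (subLists L).map fun t => t ++ [x] := by
      simp [subLists]
    rw [h, List.mem_append, List.mem_map, List.sublist_append_iff]
    simp only [ih]
    constructor
    · rintro (h | ⟨s, hs, rfl⟩)
      · exact ⟨t, [], by simp, h, by simp⟩
      · exact ⟨s, [x], rfl, hs, List.Sublist.refl _⟩
    · rintro ⟨s, r, rfl, hs, hr⟩
      rcases List.sublist_singleton.mp hr with rfl | rfl
      · left; simpa using hs
      · right; exact ⟨s, hs, rfl⟩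

def pairs (a : List α) (b : List β) : List (α × β) :=
  a.flatMap fun x => b.map fun y => (x, y)

theorem mem_pairs (a : List α) (b : List β) (x : α × β) :
    x ∈ pairs a b ↔ x.1 ∈ a ∧ x.2 ∈ b := by
  obtain ⟨x, y⟩ := x
  simp [pairs]

/-- Codes enumerate finite sets by lists in any order and with repetitions, so they are compared as
sets. -/
def sameElems [DecidableEq β] (a b : List β) : Bool :=
  (a.all fun x => b.contains x) && (b.all fun x => a.contains x)

theorem sameElems_iff [DecidableEq β] (a b : List β) :
    sameElems a b = true ↔ ∀ x, x ∈ a ↔ x ∈ b := by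
  simp only [sameElems, Bool.and_eq_true, List.all_eq_true, List.contains_iff_mem]
  exact ⟨fun h x => ⟨h.1 x, h.2 x⟩, fun h => ⟨fun x => (h x).1, fun x => (h x).2⟩⟩

variable [Primcodable α] [Primcodable β] [Primcodable γ]

@[fun_prop]
theorem primrec_words {f : α → List β} {g : α → ℕ} (hf : Primrec f) (hg : Primrec g) :
    Primrec fun a => words (f a) (g a) := by
  have h := Primrec.nat_rec' (h := fun a (x : ℕ × List (List β)) =>
    x.2.flatMap fun t => (f a).map fun b => b :: t) hg (Primrec.const [[]]) (by
      unfold Primrec₂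
      fun_prop)
  refine h.of_eq fun a => ?_
  induction g a with
  | zero => rfl
  | succ k ih => simp only [words, ← ih]

@[fun_prop]
theorem primrec_subLists {f : α → List β} (hf : Primrec f) : Primrec fun a => subLists (f a) := by
  unfold subLists
  fun_prop

@[fun_prop]
theorem primrec_pairs {f : α → List β} {g : α → List γ} (hf : Primrec f) (hg : Primrec g) :
    Primrec fun a => pairs (f a) (g a) := by
  unfold pairs
  fun_prop

@[fun_prop]
theorem primrec_sameElems [DecidableEq β] {f g : α → List β} (hf : Primrec f) (hg : Primrec g) :
    Primrec fun a => sameElems (f a) (g a) := by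
  unfold sameElems
  fun_prop

end

/-! ### Algorithms on codes -/

def sameCode (c d : LayerCode) : Bool :=
  sameElems c.1 d.1 && (sameElems c.2.1 d.2.1 && (sameElems c.2.2.1 d.2.2.1 &&
    (sameElems c.2.2.2.1 d.2.2.2.1 && (sameElems c.2.2.2.2.1 d.2.2.2.2.1 &&
      ((c.2.2.2.2.2.1 == d.2.2.2.2.2.1) && (c.2.2.2.2.2.2 == d.2.2.2.2.2.2))))))

/-- The five conditions are the proof fields of `Layer`. -/
def validCode (c : LayerCode) : Bool :=
  (c.2.2.1.all fun t => c.1.contains t.1 && c.2.1.contains t.2.2) &&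
    ((c.2.2.2.1.all fun x => c.1.contains x) && ((c.2.2.2.2.1.all fun x => c.2.1.contains x) &&
      ((c.2.2.2.2.2.1 || c.2.2.2.1.length == 0) && (c.2.2.2.2.2.2 || c.2.2.2.2.1.length == 0))))

/-- Codes of all layers over the alphabet `Fin n`. -/
def layerCodes (n w : ℕ) : List LayerCode :=
  (pairs (subLists (List.range w)) (pairs (subLists (List.range w))
    (pairs (subLists (pairs (List.range w) (pairs (List.range n) (List.range w))))
      (pairs (subLists (List.range w)) (pairs (subLists (List.range w))
        (pairs [false, true] [false, true])))))).filter validCode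

def autStep (c : AutCode) (S : List ℕ) (d : LayerCode) : List ℕ :=
  (List.range c.1).filter fun q =>
    c.2.2.2.any fun p => p.2.2 == q && (S.contains p.1 && sameCode p.2.1 d)

def autAccepts (c : AutCode) (u : List LayerCode) : Bool :=
  (u.foldl (autStep c) ((List.range c.1).filter fun q => c.2.1.contains q)).any fun q =>
    c.2.2.1.contains q

def layerStep (S : List ℕ) (d : LayerCode) (a : ℕ) : List ℕ :=
  (d.2.2.1.filter fun t => t.2.1 == a && (S.contains t.1 || d.2.2.2.1.contains t.1)).map
    fun t => t.2.2

/-- One step of the subset simulation; the first component is the unread part of the input. -/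
def codeStep (p : List ℕ × List ℕ × Bool) (d : LayerCode) : List ℕ × List ℕ × Bool :=
  (p.1.tail, layerStep p.2.1 d p.1.headI,
    (layerStep p.2.1 d p.1.headI).any fun q => d.2.2.2.2.1.contains q)

/-- Used on words as long as `u`, so the default value of `headI` in `codeStep` is never read. -/
def codeRun (u : List LayerCode) (s : List ℕ) : Bool :=
  (u.foldl codeStep (s, [], false)).2.2

def codeSim (n : ℕ) (u v : List LayerCode) : Bool :=
  u.length == v.length &&
    (words (List.range n) u.length).all fun s => codeRun u s == codeRun v s

/-- The search is finite because a simulated diagram has the same length as `v` and there are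
finitely many layers. -/
def codeSimClosure (n w : ℕ) (c : AutCode) (v : List LayerCode) : Bool :=
  (words (layerCodes n w) v.length).any fun u => autAccepts c u && codeSim n u v

def detCode (n : ℕ) (d : LayerCode) : Bool :=
  ((!d.2.2.2.2.2.1) || (sameElems d.2.2.2.1 d.1 && ((!(d.1.length == 0)) &&
    d.1.all fun p => d.1.all fun q => p == q))) &&
  ((d.2.2.1.all fun t => d.2.2.1.all fun t' =>
    (!(t.1 == t'.1 && t.2.1 == t'.2.1)) || t.2.2 == t'.2.2) &&
  (((!d.2.2.2.2.2.1) || !(d.2.2.2.1.length == 0)) &&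
    (d.1.all fun p => (List.range n).all fun a => d.2.2.1.any fun t => t.1 == p && t.2.1 == a)))

def codeODDStep (P : ℕ → LayerCode → Bool) (n : ℕ) (s : Bool × Bool × List ℕ × Bool)
    (d : LayerCode) : Bool × Bool × List ℕ × Bool :=
  (true, s.2.1 && (P n d && ((s.1 && ((!d.2.2.2.2.2.1) && ((!s.2.2.2) && sameElems d.1 s.2.2.1)))
    || ((!s.1) && d.2.2.2.2.2.1))), d.2.1, d.2.2.2.2.2.2)

def codeODD (P : ℕ → LayerCode → Bool) (n : ℕ) (u : List LayerCode) : Bool :=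
  (u.foldl (codeODDStep P n) (false, true, [], false)).1 &&
    ((u.foldl (codeODDStep P n) (false, true, [], false)).2.1 &&
      (u.foldl (codeODDStep P n) (false, true, [], false)).2.2.2)

def codeBoolComb (p : Bool → Bool → Bool) (x : ℕ × ℕ × ℕ × AutCode × AutCode)
    (u : List LayerCode) : Bool :=
  codeODD (fun _ _ => true) x.1 u &&
    p (codeSimClosure x.1 x.2.1 x.2.2.2.1 u) (codeSimClosure x.1 x.2.2.1 x.2.2.2.2 u)

section

variable {α : Type*} [Primcodable α]

@[fun_prop]
theorem primrec_sameCode {f g : α → LayerCode} (hf : Primrec f) (hg : Primrec g) :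
    Primrec fun a => sameCode (f a) (g a) := by
  unfold sameCode
  fun_prop

@[fun_prop]
theorem primrec_validCode {f : α → LayerCode} (hf : Primrec f) :
    Primrec fun a => validCode (f a) := by
  unfold validCode
  fun_prop

@[fun_prop]
theorem primrec_layerCodes {f g : α → ℕ} (hf : Primrec f) (hg : Primrec g) :
    Primrec fun a => layerCodes (f a) (g a) := by
  unfold layerCodes
  fun_prop

@[fun_prop]
theorem primrec_autStep {f : α → AutCode} {g : α → List ℕ} {h : α → LayerCode} (hf : Primrec f)
    (hg : Primrec g) (hh : Primrec h) : Primrec fun a => autStep (f a) (g a) (h a) := by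
  unfold autStep
  fun_prop

@[fun_prop]
theorem primrec_autAccepts {f : α → AutCode} {g : α → List LayerCode} (hf : Primrec f)
    (hg : Primrec g) : Primrec fun a => autAccepts (f a) (g a) := by
  unfold autAccepts
  fun_prop

@[fun_prop]
theorem primrec_layerStep {f : α → List ℕ} {g : α → LayerCode} {h : α → ℕ} (hf : Primrec f)
    (hg : Primrec g) (hh : Primrec h) : Primrec fun a => layerStep (f a) (g a) (h a) := by
  unfold layerStep
  fun_prop

@[fun_prop]
theorem primrec_codeStep {f : α → List ℕ × List ℕ × Bool} {g : α → LayerCode} (hf : Primrec f)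
    (hg : Primrec g) : Primrec fun a => codeStep (f a) (g a) := by
  unfold codeStep
  fun_prop

@[fun_prop]
theorem primrec_codeRun {f : α → List LayerCode} {g : α → List ℕ} (hf : Primrec f)
    (hg : Primrec g) : Primrec fun a => codeRun (f a) (g a) := by
  unfold codeRun
  fun_prop

@[fun_prop]
theorem primrec_codeSim {f : α → ℕ} {g h : α → List LayerCode} (hf : Primrec f)
    (hg : Primrec g) (hh : Primrec h) : Primrec fun a => codeSim (f a) (g a) (h a) := by
  unfold codeSim
  fun_prop

@[fun_prop]
theorem primrec_codeSimClosure {f g : α → ℕ} {h : α → AutCode} {k : α → List LayerCode}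
    (hf : Primrec f) (hg : Primrec g) (hh : Primrec h) (hk : Primrec k) :
    Primrec fun a => codeSimClosure (f a) (g a) (h a) (k a) := by
  unfold codeSimClosure
  fun_prop

@[fun_prop]
theorem primrec_detCode {f : α → ℕ} {g : α → LayerCode} (hf : Primrec f) (hg : Primrec g) :
    Primrec fun a => detCode (f a) (g a) := by
  unfold detCode
  fun_prop

theorem primrec_codeODD {P : ℕ → LayerCode → Bool} (hP : Primrec₂ P) {f : α → ℕ}
    {g : α → List LayerCode} (hf : Primrec f) (hg : Primrec g) :
    Primrec fun a => codeODD P (f a) (g a) := by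
  have hP : Primrec fun x : ℕ × LayerCode => P x.1 x.2 := hP
  -- The composition rule for the variable `P`, in the form that `fun_prop` can use.
  have hP' : ∀ {β : Type _} [Primcodable β] (f : β → ℕ) (g : β → LayerCode), Primrec f →
      Primrec g → Primrec fun b => P (f b) (g b) := fun f g hf hg => hP.comp (hf.pair hg)
  unfold codeODD codeODDStep
  fun_prop

set_option synthInstance.maxSize 1000 in
theorem primrec_codeBoolComb (p : Bool → Bool → Bool) : Primrec₂ (codeBoolComb p) := by
  have h := primrec_codeODD (P := fun _ _ => true) (Primrec.const true)
    (f := fun x : (ℕ × ℕ × ℕ × AutCode × AutCode) × List LayerCode => x.1.1) (g := fun x => x.2)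
    (by fun_prop) (by fun_prop)
  refine Primrec.and.comp h ((Primrec.dom_bool₂ p).comp ?_ ?_) <;> fun_prop

end

/-! ### Correctness of the algorithms on codes -/

section

variable {n w W : ℕ}

theorem Enumerates.val_mem {k : ℕ} {L : List ℕ} {S : Finset (Fin k)} (h : Enumerates Fin.val L S)
    (q : Fin k) : (q : ℕ) ∈ L ↔ q ∈ S := by
  rw [h q]
  simp [Fin.val_inj]

theorem tripleVal_injective : Function.Injective
    (fun t : Fin w × Fin n × Fin w => ((t.1 : ℕ), (t.2.1 : ℕ), (t.2.2 : ℕ))) := by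
  rintro ⟨a, b, c⟩ ⟨a', b', c'⟩ h
  simpa [Fin.ext_iff] using h

theorem Enumerates.triple_mem {L : List (ℕ × ℕ × ℕ)} {S : Finset (Fin w × Fin n × Fin w)}
    (h : Enumerates (fun t : Fin w × Fin n × Fin w => ((t.1 : ℕ), (t.2.1 : ℕ), (t.2.2 : ℕ))) L S)
    (p : Fin w) (a : Fin n) (q : Fin w) : ((p : ℕ), (a : ℕ), (q : ℕ)) ∈ L ↔ (p, a, q) ∈ S := by
  rw [h]
  constructor
  · rintro ⟨t, ht, h1⟩
    rwa [← tripleVal_injective (a₁ := t) (a₂ := (p, a, q)) h1]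
  · intro h1
    exact ⟨_, h1, rfl⟩

theorem describes_iff_sameCode {d e : LayerCode} {l : Layer (Fin n) w} (h : d.Describes l) :
    e.Describes l ↔ sameCode e d = true := by
  have key : ∀ {α β : Type} {v : α → β} {L L' : List β} {S : Finset α},
      Enumerates v L S → (Enumerates v L' S ↔ ∀ x, x ∈ L' ↔ x ∈ L) := by
    intro α β v L L' S hL
    exact forall_congr' fun x => by rw [hL x]
  obtain ⟨h1, h2, h3, h4, h5, h6, h7⟩ := h
  simp only [LayerCode.Describes, sameCode, Bool.and_eq_true, sameElems_iff, beq_iff_eq, key h1,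
    key h2, key h3, key h4, key h5, h6, h7]

/-- The list `L` enumerates the elements of a set of states. -/
def SetCode (L : List ℕ) (S : Set (Fin w)) : Prop :=
  ∀ x, x ∈ L ↔ ∃ q ∈ S, (q : ℕ) = x

theorem SetCode.val_mem {L : List ℕ} {S : Set (Fin w)} (h : SetCode L S) (q : Fin w) :
    (q : ℕ) ∈ L ↔ q ∈ S := by
  rw [h q]
  simp [Fin.val_inj]

theorem setCode_layerStep {S : List ℕ} {T : Set (Fin w)} (b : Prop) {d : LayerCode}
    {l : Layer (Fin n) w} (hd : d.Describes l) (hS : SetCode S T) (a : Fin n) :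
    SetCode (layerStep S d a) (runStep (T, b) (l, a)).1 := by
  obtain ⟨h1, h2, h3, h4, h5, h6, h7⟩ := hd
  intro x
  simp only [layerStep, List.mem_map, List.mem_filter, Bool.and_eq_true, beq_iff_eq,
    Bool.or_eq_true, List.contains_iff_mem]
  constructor
  · rintro ⟨t, ⟨ht, ha, hp⟩, rfl⟩
    obtain ⟨⟨p, a', q⟩, h, rfl⟩ := (h3 t).mp ht
    obtain rfl : a' = a := Fin.ext ha
    rw [hS.val_mem, h4.val_mem] at hp
    exact ⟨q, ⟨p, hp, h⟩, rfl⟩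
  · rintro ⟨q, ⟨p, hp, h⟩, rfl⟩
    refine ⟨_, ⟨(h3.triple_mem p a q).mpr h, rfl, ?_⟩, rfl⟩
    rwa [hS.val_mem, h4.val_mem]

theorem any_layerStep_iff {S : List ℕ} {T : Set (Fin w)} (b : Prop) {d : LayerCode}
    {l : Layer (Fin n) w} (hd : d.Describes l) (hS : SetCode S T) (a : Fin n) :
    ((layerStep S d a).any fun q => d.2.2.2.2.1.contains q) = true ↔
      (runStep (T, b) (l, a)).2 := by
  have h := setCode_layerStep b hd hS a
  simp only [List.any_eq_true, List.contains_iff_mem]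
  constructor
  · rintro ⟨x, hx, hf⟩
    obtain ⟨q, hq, rfl⟩ := (h x).mp hx
    exact ⟨q, (hd.2.2.2.2.1.val_mem q).mp hf, hq⟩
  · rintro ⟨q, hf, hq⟩
    exact ⟨q, (h q).mpr ⟨q, hq, rfl⟩, (hd.2.2.2.2.1.val_mem q).mpr hf⟩

theorem codeStep_foldl_iff {u : List LayerCode} {D : List (Layer (Fin n) w)}
    (h : List.Forall₂ LayerCode.Describes u D) : ∀ (s : List (Fin n)) (S : List ℕ)
    (T : Set (Fin w)) (b : Bool) (b' : Prop), s.length = D.length → SetCode S T →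
    (b = true ↔ b') →
    ((u.foldl codeStep (s.map Fin.val, S, b)).2.2 = true ↔ (runFrom (T, b') D s).2) := by
  induction h with
  | nil =>
    intro s S T b b' _ _ hb
    simpa [runFrom] using hb
  | @cons d l u D hd h ih =>
    intro s S T b b' hs hS hb
    cases s with
    | nil => simp at hs
    | cons a s =>
      exact ih s _ _ _ _ (by simpa using hs) (setCode_layerStep b' hd hS a)
        (any_layerStep_iff b' hd hS a)

theorem codeRun_iff {u : List LayerCode} {D : List (Layer (Fin n) w)}
    (h : List.Forall₂ LayerCode.Describes u D) {s : List (Fin n)} (hs : s.length = D.length) :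
    codeRun u (s.map Fin.val) = true ↔ (runFrom (∅, False) D s).2 :=
  codeStep_foldl_iff h s [] ∅ false False hs (by simp [SetCode]) (by simp)

theorem forall_words_range (k : ℕ) (P : List ℕ → Prop) :
    (∀ s ∈ words (List.range n) k, P s) ↔
      ∀ s : List (Fin n), s.length = k → P (s.map Fin.val) := by
  constructor
  · intro h s hs
    refine h _ ((mem_words _ _ _).mpr ⟨by simpa using hs, fun x hx => ?_⟩)
    obtain ⟨a, -, rfl⟩ := List.mem_map.mp hx
    simp
  · intro h s hs
    obtain ⟨h1, h2⟩ := (mem_words _ _ _).mp hs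
    lift s to List (Fin n) using fun x hx => List.mem_range.mp (h2 x hx) with t
    exact h t (by simpa using h1)

theorem codeSim_iff {u v : List LayerCode} {D : List (Layer (Fin n) w)}
    {D' : List (Layer (Fin n) W)} (hu : List.Forall₂ LayerCode.Describes u D)
    (hv : List.Forall₂ LayerCode.Describes v D') : codeSim n u v = true ↔ Sim D D' := by
  rw [codeSim, Bool.and_eq_true, beq_iff_eq, List.all_eq_true, hu.length_eq, hv.length_eq,
    forall_words_range D.length fun s => (codeRun u s == codeRun v s) = true]
  refine and_congr_right fun h => forall_congr' fun s => imp_congr_right fun hs => ?_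
  rw [beq_iff_eq, Bool.eq_iff_iff, codeRun_iff hu hs, codeRun_iff hv (hs.trans h)]

theorem exists_describes_of_mem_layerCodes {d : LayerCode} (hd : d ∈ layerCodes n w) :
    ∃ l : Layer (Fin n) w, d.Describes l := by
  simp only [layerCodes, List.mem_filter, mem_pairs, mem_subLists] at hd
  obtain ⟨⟨h1, h2, h3, h4, h5, -⟩, hv⟩ := hd
  simp only [validCode, Bool.and_eq_true, Bool.or_eq_true, List.all_eq_true,
    List.contains_iff_mem, beq_iff_eq, List.length_eq_zero_iff] at hv
  obtain ⟨v1, v2, v3, v4, v5⟩ := hv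
  have key : ∀ {L : List ℕ}, L.Sublist (List.range w) →
      Enumerates Fin.val L (Finset.univ.filter fun q : Fin w => (q : ℕ) ∈ L) := by
    intro L hL x
    constructor
    · intro hx
      have hxw := List.mem_range.mp (hL.subset hx)
      exact ⟨⟨x, hxw⟩, by simpa using hx, rfl⟩
    · rintro ⟨q, hq, rfl⟩
      simpa using hq
  refine ⟨{ left := Finset.univ.filter fun q : Fin w => (q : ℕ) ∈ d.1
            right := Finset.univ.filter fun q : Fin w => (q : ℕ) ∈ d.2.1
            trans := Finset.univ.filter fun t : Fin w × Fin n × Fin w =>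
              ((t.1 : ℕ), (t.2.1 : ℕ), (t.2.2 : ℕ)) ∈ d.2.2.1
            init := Finset.univ.filter fun q : Fin w => (q : ℕ) ∈ d.2.2.2.1
            final := Finset.univ.filter fun q : Fin w => (q : ℕ) ∈ d.2.2.2.2.1
            initFlag := d.2.2.2.2.2.1
            finalFlag := d.2.2.2.2.2.2
            trans_mem := ?_
            init_subset := ?_
            final_subset := ?_
            init_eq_empty := ?_
            final_eq_empty := ?_ }, key h1, key h2, ?_, key h4, key h5, rfl, rfl⟩
  · intro t ht
    simpa using v1 _ (by simpa using ht)
  · intro q hq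
    simpa using v2 _ (by simpa using hq)
  · intro q hq
    simpa using v3 _ (by simpa using hq)
  · intro h
    rw [h] at v4
    simp [v4.resolve_left (by simp)]
  · intro h
    rw [h] at v5
    simp [v5.resolve_left (by simp)]
  · intro x
    constructor
    · intro hx
      have hx' := h3.subset hx
      simp only [mem_pairs, List.mem_range] at hx'
      exact ⟨(⟨x.1, hx'.1⟩, ⟨x.2.1, hx'.2.1⟩, ⟨x.2.2, hx'.2.2⟩), by simpa using hx, rfl⟩
    · rintro ⟨t, ht, rfl⟩
      simpa using ht

/-- An arbitrary code is normalized: filtering the full ranges by its lists gives sublists of those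
ranges, as `layerCodes` requires, without changing the described layer. -/
theorem exists_mem_layerCodes (l : Layer (Fin n) w) : ∃ d ∈ layerCodes n w, d.Describes l := by
  classical
  obtain ⟨c, h1, h2, h3, h4, h5, h6, h7⟩ := exists_describes l
  have key : ∀ {L : List ℕ} {S : Finset (Fin w)}, Enumerates Fin.val L S →
      Enumerates Fin.val ((List.range w).filter fun x => x ∈ L) S := by
    intro L S h x
    rw [← h x, List.mem_filter, decide_eq_true_eq, and_iff_right_iff_imp]
    intro hx
    obtain ⟨q, -, rfl⟩ := (h x).mp hx
    simp
  have hd : LayerCode.Describes ((List.range w).filter fun x => x ∈ c.1,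
      (List.range w).filter fun x => x ∈ c.2.1,
      (pairs (List.range w) (pairs (List.range n) (List.range w))).filter fun t => t ∈ c.2.2.1,
      (List.range w).filter fun x => x ∈ c.2.2.2.1,
      (List.range w).filter fun x => x ∈ c.2.2.2.2.1, c.2.2.2.2.2.1, c.2.2.2.2.2.2) l := by
    refine ⟨key h1, key h2, ?_, key h4, key h5, h6, h7⟩
    intro x
    rw [← h3 x, List.mem_filter, decide_eq_true_eq, and_iff_right_iff_imp]
    intro hx
    obtain ⟨q, -, rfl⟩ := (h3 x).mp hx
    simp [mem_pairs]
  refine ⟨_, ?_, hd⟩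
  rw [layerCodes, List.mem_filter]
  constructor
  · simp only [mem_pairs, mem_subLists]
    refine ⟨List.filter_sublist, List.filter_sublist, List.filter_sublist, List.filter_sublist,
      List.filter_sublist, ?_, ?_⟩ <;> simp
  · obtain ⟨g1, g2, g3, g4, g5, g6, g7⟩ := hd
    simp only [validCode, Bool.and_eq_true, Bool.or_eq_true, List.all_eq_true,
      List.contains_iff_mem, beq_iff_eq, List.length_eq_zero_iff]
    have hempty : ∀ {L : List ℕ}, Enumerates Fin.val L (∅ : Finset (Fin w)) → L = [] :=
      fun h => List.eq_nil_iff_forall_not_mem.mpr fun x hx => by simpa using (h x).mp hx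
    refine ⟨?_, ?_, ?_, ?_, ?_⟩
    · intro t ht
      obtain ⟨t', ht', rfl⟩ := (g3 t).mp ht
      exact ⟨(g1.val_mem _).mpr (l.trans_mem t' ht').1, (g2.val_mem _).mpr (l.trans_mem t' ht').2⟩
    · intro x hx
      obtain ⟨q, hq, rfl⟩ := (g4 x).mp hx
      exact (g1.val_mem _).mpr (l.init_subset hq)
    · intro x hx
      obtain ⟨q, hq, rfl⟩ := (g5 x).mp hx
      exact (g2.val_mem _).mpr (l.final_subset hq)
    · rw [g6]
      by_cases h : l.initFlag = true
      · exact Or.inl h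
      · rw [l.init_eq_empty (by simpa using h)] at g4
        exact Or.inr (hempty g4)
    · rw [g7]
      by_cases h : l.finalFlag = true
      · exact Or.inl h
      · rw [l.final_eq_empty (by simpa using h)] at g5
        exact Or.inr (hempty g5)

/-- Turns a bounded search over codes into quantification over diagrams of length `k`. It requires
`P` to be independent of which codes represent the layers, which is what `hPQ` provides. -/
theorem exists_mem_words_layerCodes_iff (k : ℕ) (P : List LayerCode → Prop)
    (Q : List (Layer (Fin n) w) → Prop)
    (hPQ : ∀ u D, List.Forall₂ LayerCode.Describes u D → (P u ↔ Q D)) :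
    (∃ u ∈ words (layerCodes n w) k, P u) ↔ ∃ D, D.length = k ∧ Q D := by
  constructor
  · rintro ⟨u, hu, h⟩
    obtain ⟨rfl, h2⟩ := (mem_words _ _ _).mp hu
    obtain ⟨D, hD⟩ : ∃ D : List (Layer (Fin n) w), List.Forall₂ LayerCode.Describes u D := by
      clear h hu
      induction u with
      | nil => exact ⟨[], .nil⟩
      | cons d u ih =>
        rw [List.forall_mem_cons] at h2
        obtain ⟨l, hl⟩ := exists_describes_of_mem_layerCodes h2.1
        obtain ⟨D, hD⟩ := ih h2.2
        exact ⟨l :: D, .cons hl hD⟩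
    exact ⟨D, hD.length_eq.symm, (hPQ u D hD).mp h⟩
  · rintro ⟨D, rfl, h⟩
    choose f hf hf' using fun l : Layer (Fin n) w => exists_mem_layerCodes l
    have hD : List.Forall₂ LayerCode.Describes (D.map f) D := by
      rw [List.forall₂_map_left_iff, List.forall₂_same]
      exact fun l _ => hf' l
    refine ⟨D.map f, (mem_words _ _ _).mpr ⟨by simp, fun x hx => ?_⟩, (hPQ _ D hD).mpr h⟩
    obtain ⟨l, -, rfl⟩ := List.mem_map.mp hx
    exact hf l

theorem setCode_range_filter {m : ℕ} {p : ℕ → Bool} {S : Set (Fin m)}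
    (h : ∀ q : Fin m, p q = true ↔ q ∈ S) : SetCode ((List.range m).filter p) S := by
  intro x
  rw [List.mem_filter, List.mem_range]
  constructor
  · rintro ⟨hx, hp⟩
    exact ⟨⟨x, hx⟩, (h ⟨x, hx⟩).mp hp, rfl⟩
  · rintro ⟨q, hq, rfl⟩
    exact ⟨q.2, (h q).mpr hq⟩

theorem setCode_autStep (c : AutCode) {S : List ℕ} {T : Set (Fin c.1)} (hS : SetCode S T)
    {d : LayerCode} {l : Layer (Fin n) w} (hd : d.Describes l) :
    SetCode (autStep c S d) ((c.toNFA n w).stepSet T l) := by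
  refine setCode_range_filter fun q => ?_
  simp only [List.any_eq_true, Bool.and_eq_true, beq_iff_eq, List.contains_iff_mem,
    ← describes_iff_sameCode hd, NFA.mem_stepSet]
  constructor
  · rintro ⟨⟨p, e, q'⟩, h, hq, hp, he⟩
    obtain rfl : q' = (q : ℕ) := hq
    obtain ⟨t, ht, rfl⟩ := (hS p).mp hp
    exact ⟨t, ht, e, he, h⟩
  · rintro ⟨t, ht, e, he, h⟩
    exact ⟨_, h, rfl, (hS.val_mem t).mpr ht, he⟩

theorem autAccepts_iff (c : AutCode) {u : List LayerCode} {D : List (Layer (Fin n) w)}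
    (h : List.Forall₂ LayerCode.Describes u D) :
    autAccepts c u = true ↔ D ∈ (c.toNFA n w).accepts := by
  have hfold : SetCode (u.foldl (autStep c) ((List.range c.1).filter fun q => c.2.1.contains q))
      (D.foldl (c.toNFA n w).stepSet (c.toNFA n w).start) := by
    -- The lists computed on codes keep representing the state sets of the subset construction.
    refine List.rel_foldl (R := LayerCode.Describes) ?_ ?_ h
    · intro S T hS d l hd
      exact setCode_autStep c hS hd
    · exact setCode_range_filter fun q => by simp [AutCode.toNFA]
  rw [autAccepts, List.any_eq_true, NFA.mem_accepts]
  constructor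
  · rintro ⟨x, hx, hacc⟩
    obtain ⟨q, hq, rfl⟩ := (hfold x).mp hx
    exact ⟨q, List.contains_iff_mem.mp hacc, hq⟩
  · rintro ⟨q, hacc, hq⟩
    exact ⟨q, (hfold q).mpr ⟨q, hq, rfl⟩, List.contains_iff_mem.mpr hacc⟩

theorem codeSimClosure_iff (c : AutCode) {v : List LayerCode} {D' : List (Layer (Fin n) W)}
    (hv : List.Forall₂ LayerCode.Describes v D') :
    codeSimClosure n w c v = true ↔ D' ∈ simClosure W (c.toNFA n w).accepts := by
  rw [codeSimClosure, List.any_eq_true,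
    exists_mem_words_layerCodes_iff _ _ (fun D => D ∈ (c.toNFA n w).accepts ∧ Sim D D')]
  · constructor
    · rintro ⟨D, -, h⟩
      exact ⟨D, h⟩
    · rintro ⟨D, h1, h2⟩
      exact ⟨D, h2.1.trans hv.length_eq.symm, h1, h2⟩
  · intro u D hu
    rw [Bool.and_eq_true, autAccepts_iff c hu, codeSim_iff hu hv]

theorem length_beq_zero_iff {L : List ℕ} {S : Finset (Fin w)} (h : Enumerates Fin.val L S) :
    (L.length == 0) = false ↔ S.Nonempty := by
  rw [beq_eq_false_iff_ne, ne_eq, List.length_eq_zero_iff]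
  constructor
  · intro hL
    obtain ⟨x, hx⟩ := List.exists_mem_of_ne_nil L hL
    obtain ⟨q, hq, -⟩ := (h x).mp hx
    exact ⟨q, hq⟩
  · rintro ⟨q, hq⟩ rfl
    simpa using (h q).mpr ⟨q, hq, rfl⟩

theorem detCode_iff {d : LayerCode} {l : Layer (Fin n) w} (hd : d.Describes l) :
    detCode n d = true ↔ l.Deterministic ∧ l.Complete := by
  obtain ⟨h1, h2, h3, h4, h5, h6, h7⟩ := hd
  have hsame : (∀ x, x ∈ d.2.2.2.1 ↔ x ∈ d.1) ↔ l.init = l.left := by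
    constructor
    · intro h
      ext q
      rw [← h4.val_mem, ← h1.val_mem, h]
    · intro h x
      rw [h4 x, h1 x, h]
  have hcard : (l.left.Nonempty ∧ ∀ p ∈ d.1, ∀ q ∈ d.1, p = q) ↔ l.left.card = 1 := by
    rw [Finset.card_eq_one]
    constructor
    · rintro ⟨⟨p, hp⟩, h⟩
      refine ⟨p, Finset.eq_singleton_iff_unique_mem.mpr ⟨hp, fun q hq => ?_⟩⟩
      exact Fin.ext (h _ ((h1.val_mem q).mpr hq) _ ((h1.val_mem p).mpr hp))
    · rintro ⟨p, hp⟩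
      refine ⟨by simp [hp], fun x hx y hy => ?_⟩
      obtain ⟨q, hq, rfl⟩ := (h1 x).mp hx
      obtain ⟨r, hr, rfl⟩ := (h1 y).mp hy
      rw [hp, Finset.mem_singleton] at hq hr
      rw [hq, hr]
  have hdet : (∀ t ∈ d.2.2.1, ∀ t' ∈ d.2.2.1, t.1 = t'.1 → t.2.1 = t'.2.1 → t.2.2 = t'.2.2) ↔
      ∀ p ∈ l.left, ∀ a : Fin n, ∀ q ∈ l.right, ∀ q' ∈ l.right,
        (p, a, q) ∈ l.trans → (p, a, q') ∈ l.trans → q = q' := by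
    constructor
    · intro h p _ a q _ q' _ hq hq'
      exact Fin.ext (h _ ((h3.triple_mem p a q).mpr hq) _ ((h3.triple_mem p a q').mpr hq') rfl rfl)
    · intro h t ht t' ht' e1 e2
      obtain ⟨⟨p, a, q⟩, hq, rfl⟩ := (h3 t).mp ht
      obtain ⟨⟨p', a', q'⟩, hq', rfl⟩ := (h3 t').mp ht'
      obtain rfl : p = p' := Fin.ext e1
      obtain rfl : a = a' := Fin.ext e2
      exact congrArg Fin.val (h p (l.trans_mem _ hq).1 a q (l.trans_mem _ hq).2 q'
        (l.trans_mem _ hq').2 hq hq')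
  have hcomp : (∀ p ∈ d.1, ∀ a ∈ List.range n, ∃ t ∈ d.2.2.1, t.1 = p ∧ t.2.1 = a) ↔
      ∀ p ∈ l.left, ∀ a : Fin n, ∃ q ∈ l.right, (p, a, q) ∈ l.trans := by
    constructor
    · intro h p hp a
      obtain ⟨t, ht, e1, e2⟩ := h _ ((h1.val_mem p).mpr hp) a (by simp)
      obtain ⟨⟨p', a', q⟩, hq, rfl⟩ := (h3 t).mp ht
      obtain rfl : p' = p := Fin.ext e1
      obtain rfl : a' = a := Fin.ext e2
      exact ⟨q, (l.trans_mem _ hq).2, hq⟩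
    · intro h x hx a ha
      obtain ⟨p, hp, rfl⟩ := (h1 x).mp hx
      obtain ⟨q, -, hq⟩ := h p hp ⟨a, List.mem_range.mp ha⟩
      exact ⟨_, (h3.triple_mem _ _ _).mpr hq, rfl, rfl⟩
  have himp : ∀ (b : Bool) (X : Prop), (b = false ∨ X) ↔ (b = true → X) := by
    intro b X
    cases b <;> simp
  rw [Layer.Deterministic, Layer.Complete, ← hdet, ← hcomp, ← hcard, ← hsame]
  simp only [detCode, Bool.and_eq_true, Bool.or_eq_true, Bool.not_eq_true', sameElems_iff,
    List.all_eq_true, List.any_eq_true, himp, beq_iff_eq, h6, length_beq_zero_iff h1,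
    length_beq_zero_iff h4, and_imp, and_assoc]

theorem codeODD_iff {P : ℕ → LayerCode → Bool} {Q : Layer (Fin n) w → Prop}
    (hPQ : ∀ d l, d.Describes l → (P n d = true ↔ Q l)) {u : List LayerCode}
    {D : List (Layer (Fin n) w)} (h : List.Forall₂ LayerCode.Describes u D) :
    codeODD P n u = true ↔ D ∈ ({D | IsODD D ∧ ∀ l ∈ D, Q l} : Set (List (Layer (Fin n) w))) := by
  -- Invariant between the two folds: Booleans reflect propositions and the stored list enumerates
  -- the frontier.
  let R : Bool × Bool × List ℕ × Bool → Prop × Prop × Finset (Fin w) × Prop → Prop :=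
    fun s t => (s.1 = true ↔ t.1) ∧ (s.2.1 = true ↔ t.2.1) ∧ Enumerates Fin.val s.2.2.1 t.2.2.1 ∧
      (s.2.2.2 = true ↔ t.2.2.2)
  have hfold : R (u.foldl (codeODDStep P n) (false, true, [], false))
      (D.foldl (oddStep Q) (False, True, ∅, False)) := by
    refine List.rel_foldl (R := LayerCode.Describes) ?_ ?_ h
    · rintro s t ⟨g1, g2, g3, g4⟩ d l hd
      have hsame : sameElems d.1 s.2.2.1 = true ↔ l.left = t.2.2.1 := by
        rw [sameElems_iff]
        constructor
        · intro h
          ext q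
          rw [← hd.1.val_mem, ← g3.val_mem, h]
        · intro h x
          rw [hd.1 x, g3 x, h]
      refine ⟨by simp [codeODDStep, oddStep], ?_, hd.2.1, ?_⟩
      · simp only [codeODDStep, oddStep, Bool.and_eq_true, Bool.or_eq_true, Bool.not_eq_true',
          hsame, hPQ d l hd, g1, g2, hd.2.2.2.2.2.1, ← g4, Bool.not_eq_true, ← Bool.not_eq_true s.1]
      · simp only [codeODDStep, oddStep, hd.2.2.2.2.2.2]
    · exact ⟨by simp, by simp, by simp [Enumerates], by simp⟩
  rw [← oddDFA_accepts]
  simp only [codeODD, Bool.and_eq_true, hfold.1, hfold.2.1, hfold.2.2.2]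
  rfl

theorem codeBoolComb_iff (p : Bool → Bool → Bool) {p' : Prop → Prop → Prop}
    (hp : ∀ a b : Bool, p a b = true ↔ p' (a = true) (b = true)) {w₁ w₂ : ℕ} (c₁ c₂ : AutCode)
    {u : List LayerCode} {D : List (Layer (Fin n) W)}
    (h : List.Forall₂ LayerCode.Describes u D) :
    codeBoolComb p (n, w₁, w₂, c₁, c₂) u = true ↔
      D ∈ boolComb p' W (c₁.toNFA n w₁).accepts (c₂.toNFA n w₂).accepts := by
  rw [codeBoolComb, Bool.and_eq_true, hp, codeSimClosure_iff c₁ h, codeSimClosure_iff c₂ h,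
    codeODD_iff (Q := fun _ => True) (by simp) h]
  rfl

end

/-! ### Searching for automata -/

section

/-- Whether some string of layer codes of length less than `N` satisfies `q`. -/
def searchShort (n W N : ℕ) (q : List LayerCode → Bool) : Bool :=
  (List.range N).any fun k => (words (layerCodes n W) k).any q

/-- The state bound `N` makes the finite search exhaustive, by `RegLe.exists_short`. -/
theorem searchShort_iff {n W N : ℕ} {T : Language (Layer (Fin n) W)} (hT : RegLe T N)
    {q : List LayerCode → Bool}
    (hq : ∀ u D, List.Forall₂ LayerCode.Describes u D → (q u = true ↔ D ∈ T)) :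
    searchShort n W N q = true ↔ ∃ D, D ∈ T := by
  simp only [searchShort, List.any_eq_true, List.mem_range,
    exists_mem_words_layerCodes_iff _ (fun u => q u = true) (fun D => D ∈ T) hq]
  constructor
  · rintro ⟨k, -, D, -, hD⟩
    exact ⟨D, hD⟩
  · intro h
    obtain ⟨D, hD, hlen⟩ := hT.exists_short h
    exact ⟨_, hlen, D, rfl, hD⟩

@[fun_prop]
theorem primrec_searchShort {α : Type*} [Primcodable α] {n W N : α → ℕ}
    {q : α → List LayerCode → Bool} (hn : Primrec n) (hW : Primrec W) (hN : Primrec N)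
    (hq : Primrec fun x : α × List LayerCode => q x.1 x.2) :
    Primrec fun a => searchShort (n a) (W a) (N a) (q a) := by
  have hq' : ∀ {β : Type _} [Primcodable β] (f : β → α) (g : β → List LayerCode), Primrec f →
      Primrec g → Primrec fun b => q (f b) (g b) := fun f g hf hg => hq.comp (hf.pair hg)
  unfold searchShort
  fun_prop

/-- Regular languages that are given by a membership algorithm and a bound on the number of states
have computable automata. -/
theorem exists_computable_code {α : Type*} [Primcodable α] {n W N : α → ℕ}
    {q : α → List LayerCode → Bool} (hn : Primrec n) (hW : Primrec W) (hN : Primrec N)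
    (hq : Primrec₂ q) (T : ∀ a, Language (Layer (Fin (n a)) (W a))) (hT : ∀ a, RegLe (T a) (N a))
    (hqT : ∀ a u D, List.Forall₂ LayerCode.Describes u D → (q a u = true ↔ D ∈ T a)) :
    ∃ f : α → AutCode, Computable f ∧ ∀ a, ((f a).toNFA (n a) (W a)).accepts = T a := by
  have hq' : ∀ {β : Type _} [Primcodable β] (f : β → α) (g : β → List LayerCode), Primrec f →
      Primrec g → Primrec fun b => q (f b) (g b) := fun f g hf hg => hq.comp hf hg
  -- Looks for a word in the symmetric difference of `T a` and the language of `c`. The product of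
  -- an automaton for `T a` with the determinization of `c` has at most `N a * 2 ^ c.1` states.
  let differ : α → AutCode → Bool := fun a c =>
    searchShort (n a) (W a) (N a * 2 ^ c.1) fun u => !(q a u == autAccepts c u)
  have hdiffer : ∀ a c, differ a c = false ↔ (c.toNFA (n a) (W a)).accepts = T a := by
    intro a c
    have hreg : RegLe ({D | ¬ (D ∈ T a ↔ D ∈ (c.toNFA (n a) (W a)).accepts)} : Set (List _))
        (N a * 2 ^ c.1) := by
      have h := RegLe.of_nfa (c.toNFA (n a) (W a))
      rw [Nat.card_fin] at h
      exact (hT a).op h fun x y => ¬ (x ↔ y)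
    have h := searchShort_iff hreg (q := fun u => !(q a u == autAccepts c u)) (by
      intro u D h
      change _ ↔ ¬ _
      rw [← hqT a u D h, ← autAccepts_iff c h, ← Bool.eq_iff_iff]
      simp)
    rw [← Bool.not_eq_true, h, not_exists]
    constructor
    · intro h'
      ext D
      exact (not_not.mp (h' D)).symm
    · intro h' D
      change ¬ ¬ _
      rw [h', not_not]
  have hprim : Primrec₂ differ := by
    unfold Primrec₂
    fun_prop
  -- Candidates are all numbers, decoded as codes; the first one that does not differ from `T a` is
  -- the output.
  let g : α → ℕ → Option AutCode := fun a k =>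
    (Encodable.decode k : Option AutCode).bind fun c => bif differ a c then none else some c
  have hg : Primrec₂ g := Primrec.option_bind (Primrec.decode.comp Primrec.snd)
    (Primrec.cond (hprim.comp (Primrec.fst.comp Primrec.fst) Primrec.snd) (Primrec.const none)
      (Primrec.option_some.comp Primrec.snd))
  have hmem : ∀ a k c, c ∈ g a k → (c.toNFA (n a) (W a)).accepts = T a := by
    intro a k c h
    obtain ⟨c', -, h⟩ := Option.bind_eq_some_iff.mp h
    cases hc : differ a c'
    · rw [hc] at h
      obtain rfl : c' = c := by simpa using h
      exact (hdiffer a c').mp hc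
    · rw [hc] at h
      simp at h
  -- The unbounded search halts: `T a` is regular, and each automaton on `Fin m` has a code.
  have hdom : ∀ a, (Nat.rfindOpt (g a)).Dom := by
    intro a
    rw [Nat.rfindOpt_dom]
    obtain ⟨m, G, hG⟩ := (hT a).exists_nfa
    obtain ⟨S, A, R, hc⟩ := exists_code G
    refine ⟨Encodable.encode ((m, S, A, R) : AutCode), (m, S, A, R), ?_⟩
    have hd : differ a (m, S, A, R) = false := (hdiffer a _).mpr (by rw [← hG, ← hc])
    simp [g, hd]
  refine ⟨fun a => (Nat.rfindOpt (g a)).get (hdom a), ?_, fun a => ?_⟩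
  · exact (Partrec.rfindOpt hg.to_comp).of_eq_tot fun a => Part.get_mem _
  · obtain ⟨k, hk⟩ := Nat.rfindOpt_spec (Part.get_mem (hdom a))
    exact hmem a k _ hk

theorem exists_computable_detODDs : ∃ det : ℕ × ℕ → AutCode, Computable det ∧
    ∀ n w, ((det (n, w)).toNFA n w).accepts = detODDs (Fin n) w := by
  obtain ⟨f, hf, h⟩ := exists_computable_code (α := ℕ × ℕ) (n := fun x => x.1) (W := fun x => x.2)
    (N := fun x => 2 * (2 * (2 ^ x.2 * 2))) (q := fun x u => codeODD detCode x.1 u)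
    (by fun_prop) (by fun_prop) (by fun_prop)
    (primrec_codeODD (by unfold Primrec₂; fun_prop) (by fun_prop) (by fun_prop))
    (fun x => detODDs (Fin x.1) x.2) (fun x => RegLe.isODD _)
    (fun x u D h => codeODD_iff (fun d l hd => detCode_iff hd) h)
  exact ⟨f, hf, fun n w => h (n, w)⟩

theorem regLe_boolComb_code (p : Prop → Prop → Prop) (n w₁ w₂ W : ℕ) (c₁ c₂ : AutCode) :
    RegLe (boolComb p W ((c₁.toNFA n w₁).accepts : Set (List _)) (c₂.toNFA n w₂).accepts)
      (boolCombBound W w₁ (2 ^ c₁.1) w₂ (2 ^ c₂.1)) := by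
  have h₁ := RegLe.of_nfa (c₁.toNFA n w₁)
  have h₂ := RegLe.of_nfa (c₂.toNFA n w₂)
  rw [Nat.card_fin] at h₁ h₂
  exact h₁.boolComb p W h₂

@[fun_prop]
theorem primrec_boolCombBound {α : Type*} [Primcodable α] {f g h k m : α → ℕ} (hf : Primrec f)
    (hg : Primrec g) (hh : Primrec h) (hk : Primrec k) (hm : Primrec m) :
    Primrec fun a => boolCombBound (f a) (g a) (h a) (k a) (m a) := by
  unfold boolCombBound
  fun_prop

set_option synthInstance.maxSize 1000 in
-- The target width `W` and both source widths are separate inputs, so that intersection, union,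
-- difference and the width-bounded complement are all instances.
theorem exists_computable_boolComb (p : Bool → Bool → Bool) {p' : Prop → Prop → Prop}
    (hp : ∀ a b : Bool, p a b = true ↔ p' (a = true) (b = true)) (hp' : ¬ p' False False) :
    ∃ f : ℕ × ℕ × ℕ × ℕ × AutCode × AutCode → AutCode, Computable f ∧
      ∀ W n w₁ w₂ c₁ c₂, w₁ ≤ W → w₂ ≤ W → c₁.IsSOFA n w₁ → c₂.IsSOFA n w₂ →
        (f (W, n, w₁, w₂, c₁, c₂)).IsSOFA n W ∧
        (f (W, n, w₁, w₂, c₁, c₂)).secondLang n W =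
          {X | p' (X ∈ c₁.secondLang n w₁) (X ∈ c₂.secondLang n w₂)} := by
  obtain ⟨f, hf, h⟩ := exists_computable_code (α := ℕ × ℕ × ℕ × ℕ × AutCode × AutCode)
    (n := fun x => x.2.1) (W := fun x => x.1)
    (N := fun x => boolCombBound x.1 x.2.2.1 (2 ^ x.2.2.2.2.1.1) x.2.2.2.1 (2 ^ x.2.2.2.2.2.1))
    (q := fun x u => codeBoolComb p x.2 u)
    (by fun_prop) (by fun_prop) (by fun_prop)
    ((primrec_codeBoolComb p).comp (by fun_prop) (by fun_prop))
    (fun x => boolComb p' x.1 (x.2.2.2.2.1.toNFA x.2.1 x.2.2.1).accepts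
      (x.2.2.2.2.2.toNFA x.2.1 x.2.2.2.1).accepts)
    (fun x => regLe_boolComb_code _ _ _ _ _ _ _)
    (fun x u D h => codeBoolComb_iff p hp _ _ h)
  refine ⟨f, hf, fun W n w₁ w₂ c₁ c₂ h₁ h₂ hc₁ hc₂ => ?_⟩
  exact secondLang_boolComb hp' h₁ h₂ hc₁ hc₂ (h (W, n, w₁, w₂, c₁, c₂))

set_option synthInstance.maxSize 1000 in
-- No automaton has to be computed. The class is empty exactly if `boolComb` has no member, and
-- width `w` already suffices to represent all languages involved.
theorem exists_computable_isEmpty (p : Bool → Bool → Bool) {p' : Prop → Prop → Prop}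
    (hp : ∀ a b : Bool, p a b = true ↔ p' (a = true) (b = true)) (hp' : ¬ p' False False) :
    ∃ f : ℕ × ℕ × AutCode × AutCode → Bool, Computable f ∧
      ∀ n w c₁ c₂, c₁.IsSOFA n w → c₂.IsSOFA n w →
        (f (n, w, c₁, c₂) = true ↔
          ({X | p' (X ∈ c₁.secondLang n w) (X ∈ c₂.secondLang n w)} : Set _) = ∅) := by
  have hq := primrec_codeBoolComb p
  have hq' : ∀ {β : Type} [Primcodable β] (f : β → ℕ × ℕ × ℕ × AutCode × AutCode)
      (g : β → List LayerCode), Primrec f → Primrec g →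
      Primrec fun b => codeBoolComb p (f b) (g b) := fun f g hf hg => hq.comp hf hg
  let f : ℕ × ℕ × AutCode × AutCode → Bool := fun x =>
    !(searchShort x.1 x.2.1 (boolCombBound x.2.1 x.2.1 (2 ^ x.2.2.1.1) x.2.1 (2 ^ x.2.2.2.1))
      fun u => codeBoolComb p (x.1, x.2.1, x.2.1, x.2.2.1, x.2.2.2) u)
  have hf : Primrec f := by fun_prop
  refine ⟨f, hf.to_comp, fun n w c₁ c₂ hc₁ hc₂ => ?_⟩
  have hreg := regLe_boolComb_code p' n w w w c₁ c₂
  obtain ⟨m, G, hG⟩ := hreg.exists_nfa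
  change f _ = true ↔ ({X | p' (X ∈ secondLang (c₁.toNFA n w)) (X ∈ secondLang (c₂.toNFA n w))} :
    Set _) = ∅
  rw [← (secondLang_boolComb hp' le_rfl le_rfl hc₁ hc₂ hG).2, Bool.not_eq_true',
    ← Bool.not_eq_true, searchShort_iff hreg fun u D h => codeBoolComb_iff p hp _ _ h, ← hG,
    Set.eq_empty_iff_forall_notMem, not_exists]
  constructor
  · rintro h _ ⟨D, hD, rfl⟩
    exact h D hD
  · intro h D hD
    exact h _ ⟨D, hD, rfl⟩

end

/-! ### Closure over arbitrary finite alphabets -/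

section

variable {A : Type*} {w₁ w₂ W : ℕ} {σ₁ σ₂ : Type*} [Finite σ₁] [Finite σ₂]

theorem exists_sofa_boolComb {p : Prop → Prop → Prop} (hp : ¬ p False False) (h₁ : w₁ ≤ W)
    (h₂ : w₂ ≤ W) {F₁ : NFA (Layer A w₁) σ₁} {F₂ : NFA (Layer A w₂) σ₂}
    (hF₁ : IsSOFA F₁) (hF₂ : IsSOFA F₂) :
    ∃ (m : ℕ) (G : NFA (Layer A W) (Fin m)), IsSOFA G ∧
      secondLang G = {X | p (X ∈ secondLang F₁) (X ∈ secondLang F₂)} := by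
  obtain ⟨m, G, hG⟩ := ((RegLe.of_nfa F₁).boolComb p W (RegLe.of_nfa F₂)).exists_nfa
  exact ⟨m, G, secondLang_boolComb hp h₁ h₂ hF₁ hF₂ hG⟩

theorem exists_sofa_detLangs (A : Type*) (w : ℕ) :
    ∃ (m : ℕ) (G : NFA (Layer A w) (Fin m)), IsSOFA G ∧ secondLang G = detLangs A w := by
  obtain ⟨m, G, hG⟩ :=
    (RegLe.isODD fun l : Layer A w => l.Deterministic ∧ l.Complete).exists_nfa
  exact ⟨m, G, secondLang_detODDs hG⟩

end

end SOFA

theorem theorem4p1 :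
    -- closure, over an arbitrary finite non-empty alphabet
    (∀ (A : Type*) [Finite A] [Nonempty A] (w : ℕ), 0 < w →
      ∀ (σ σ₁ σ₂ : Type*) [Finite σ] [Finite σ₁] [Finite σ₂]
        (F : NFA (SOFA.Layer A w) σ) (F₁ : NFA (SOFA.Layer A w) σ₁)
        (F₂ : NFA (SOFA.Layer A w) σ₂),
        SOFA.IsSOFA F → SOFA.IsSOFA F₁ → SOFA.IsSOFA F₂ →
        (∃ (m : ℕ) (G : NFA (SOFA.Layer A (2 ^ w)) (Fin m)), SOFA.IsSOFA G ∧
          SOFA.secondLang G = SOFA.secondLang F₁ ∩ SOFA.secondLang F₂) ∧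
        (∃ (m : ℕ) (G : NFA (SOFA.Layer A (2 ^ w)) (Fin m)), SOFA.IsSOFA G ∧
          SOFA.secondLang G = SOFA.secondLang F₁ ∪ SOFA.secondLang F₂) ∧
        (∃ (m : ℕ) (G : NFA (SOFA.Layer A (2 ^ w)) (Fin m)), SOFA.IsSOFA G ∧
          SOFA.secondLang G = SOFA.secondLang F₁ \ SOFA.secondLang F₂) ∧
        (∃ (m : ℕ) (G : NFA (SOFA.Layer A w) (Fin m)), SOFA.IsSOFA G ∧
          SOFA.secondLang G = SOFA.detLangs A w) ∧
        (∀ w' : ℕ, 0 < w' →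
          ∃ (m : ℕ) (G : NFA (SOFA.Layer A (2 ^ max w w')) (Fin m)), SOFA.IsSOFA G ∧
            SOFA.secondLang G = SOFA.widthCompl w' (SOFA.secondLang F))) ∧
    -- the automata can be computed, uniformly in the alphabet, the widths and the given automata
    (∃ cap : ℕ × ℕ × SOFA.AutCode × SOFA.AutCode → SOFA.AutCode, Computable cap ∧
      ∀ n w : ℕ, 0 < n → 0 < w → ∀ c₁ c₂ : SOFA.AutCode, c₁.IsSOFA n w → c₂.IsSOFA n w →
        (cap (n, w, c₁, c₂)).IsSOFA n (2 ^ w) ∧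
        (cap (n, w, c₁, c₂)).secondLang n (2 ^ w) = c₁.secondLang n w ∩ c₂.secondLang n w) ∧
    (∃ cup : ℕ × ℕ × SOFA.AutCode × SOFA.AutCode → SOFA.AutCode, Computable cup ∧
      ∀ n w : ℕ, 0 < n → 0 < w → ∀ c₁ c₂ : SOFA.AutCode, c₁.IsSOFA n w → c₂.IsSOFA n w →
        (cup (n, w, c₁, c₂)).IsSOFA n (2 ^ w) ∧
        (cup (n, w, c₁, c₂)).secondLang n (2 ^ w) = c₁.secondLang n w ∪ c₂.secondLang n w) ∧
    (∃ diff : ℕ × ℕ × SOFA.AutCode × SOFA.AutCode → SOFA.AutCode, Computable diff ∧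
      ∀ n w : ℕ, 0 < n → 0 < w → ∀ c₁ c₂ : SOFA.AutCode, c₁.IsSOFA n w → c₂.IsSOFA n w →
        (diff (n, w, c₁, c₂)).IsSOFA n (2 ^ w) ∧
        (diff (n, w, c₁, c₂)).secondLang n (2 ^ w) = c₁.secondLang n w \ c₂.secondLang n w) ∧
    (∃ det : ℕ × ℕ → SOFA.AutCode, Computable det ∧
      ∀ n w : ℕ, 0 < n → 0 < w →
        (det (n, w)).IsSOFA n w ∧ (det (n, w)).secondLang n w = SOFA.detLangs (Fin n) w) ∧
    (∃ compl : ℕ × ℕ × ℕ × SOFA.AutCode → SOFA.AutCode, Computable compl ∧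
      ∀ n w w' : ℕ, 0 < n → 0 < w → 0 < w' → ∀ c : SOFA.AutCode, c.IsSOFA n w →
        (compl (n, w, w', c)).IsSOFA n (2 ^ max w w') ∧
        (compl (n, w, w', c)).secondLang n (2 ^ max w w') =
          SOFA.widthCompl w' (c.secondLang n w)) ∧
    -- decidability of disjointness and of inclusion
    (∃ disj : ℕ × ℕ × SOFA.AutCode × SOFA.AutCode → Bool, Computable disj ∧
      ∀ n w : ℕ, 0 < n → 0 < w → ∀ c₁ c₂ : SOFA.AutCode, c₁.IsSOFA n w → c₂.IsSOFA n w →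
        (disj (n, w, c₁, c₂) = true ↔ c₁.secondLang n w ∩ c₂.secondLang n w = ∅)) ∧
    (∃ incl : ℕ × ℕ × SOFA.AutCode × SOFA.AutCode → Bool, Computable incl ∧
      ∀ n w : ℕ, 0 < n → 0 < w → ∀ c₁ c₂ : SOFA.AutCode, c₁.IsSOFA n w → c₂.IsSOFA n w →
        (incl (n, w, c₁, c₂) = true ↔ c₁.secondLang n w ⊆ c₂.secondLang n w)) := by
  have hle : ∀ w, w ≤ 2 ^ w := fun w => Nat.lt_two_pow_self.le
  have hle₁ : ∀ w w', w ≤ 2 ^ max w w' := fun w w' => (le_max_left w w').trans (hle _)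
  have hle₂ : ∀ w w', w' ≤ 2 ^ max w w' := fun w w' => (le_max_right w w').trans (hle _)
  have hand : ∀ a b : Bool, (a && b) = true ↔ (a = true ∧ b = true) := by simp
  have hor : ∀ a b : Bool, (a || b) = true ↔ (a = true ∨ b = true) := by simp
  have hdiff : ∀ a b : Bool, (a && !b) = true ↔ (a = true ∧ ¬ b = true) := by simp
  have harg : Computable fun x : ℕ × ℕ × SOFA.AutCode × SOFA.AutCode =>
      (2 ^ x.2.1, x.1, x.2.1, x.2.1, x.2.2.1, x.2.2.2) :=
    Primrec.to_comp (by fun_prop)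
  obtain ⟨det, hdetc, hdet⟩ := SOFA.exists_computable_detODDs
  obtain ⟨cap, hcapc, hcap⟩ := SOFA.exists_computable_boolComb and (p' := And) hand (by simp)
  obtain ⟨cup, hcupc, hcup⟩ := SOFA.exists_computable_boolComb or (p' := Or) hor (by simp)
  obtain ⟨diff, hdiffc, hdiff'⟩ := SOFA.exists_computable_boolComb (fun a b => a && !b)
    (p' := fun a b => a ∧ ¬ b) hdiff (by simp)
  obtain ⟨disj, hdisjc, hdisj⟩ := SOFA.exists_computable_isEmpty and (p' := And) hand (by simp)
  obtain ⟨incl, hinclc, hincl⟩ := SOFA.exists_computable_isEmpty (fun a b => a && !b)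
    (p' := fun a b => a ∧ ¬ b) hdiff (by simp)
  refine ⟨?_, ?_, ?_, ?_, ?_, ?_, ?_, ?_⟩
  · intro A _ _ w _ σ σ₁ σ₂ _ _ _ F F₁ F₂ hF hF₁ hF₂
    refine ⟨SOFA.exists_sofa_boolComb (p := And) (by simp) (hle w) (hle w) hF₁ hF₂,
      SOFA.exists_sofa_boolComb (p := Or) (by simp) (hle w) (hle w) hF₁ hF₂,
      SOFA.exists_sofa_boolComb (p := fun a b => a ∧ ¬ b) (by simp) (hle w) (hle w) hF₁ hF₂,
      SOFA.exists_sofa_detLangs A w, fun w' _ => ?_⟩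
    obtain ⟨m, G, hG, hG'⟩ := SOFA.exists_sofa_detLangs A w'
    rw [SOFA.widthCompl, ← hG']
    exact SOFA.exists_sofa_boolComb (p := fun a b => a ∧ ¬ b) (by simp) (hle₂ w w') (hle₁ w w')
      hG hF
  · exact ⟨_, hcapc.comp harg, fun n w _ _ c₁ c₂ h₁ h₂ =>
      hcap (2 ^ w) n w w c₁ c₂ (hle w) (hle w) h₁ h₂⟩
  · exact ⟨_, hcupc.comp harg, fun n w _ _ c₁ c₂ h₁ h₂ =>
      hcup (2 ^ w) n w w c₁ c₂ (hle w) (hle w) h₁ h₂⟩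
  · exact ⟨_, hdiffc.comp harg, fun n w _ _ c₁ c₂ h₁ h₂ =>
      hdiff' (2 ^ w) n w w c₁ c₂ (hle w) (hle w) h₁ h₂⟩
  · exact ⟨det, hdetc, fun n w _ _ => SOFA.secondLang_detODDs (hdet n w)⟩
  · have hpair : Primrec fun x : ℕ × ℕ × ℕ × SOFA.AutCode => (x.1, x.2.2.1) := by fun_prop
    have hW : Primrec fun x : ℕ × ℕ × ℕ × SOFA.AutCode => 2 ^ max x.2.1 x.2.2.1 := by fun_prop
    have hn : Primrec fun x : ℕ × ℕ × ℕ × SOFA.AutCode => x.1 := by fun_prop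
    have hw : Primrec fun x : ℕ × ℕ × ℕ × SOFA.AutCode => x.2.1 := by fun_prop
    have hw' : Primrec fun x : ℕ × ℕ × ℕ × SOFA.AutCode => x.2.2.1 := by fun_prop
    have hc : Primrec fun x : ℕ × ℕ × ℕ × SOFA.AutCode => x.2.2.2 := by fun_prop
    -- The complement is the difference of the automaton computed for `detLangs` at width `w'` and
    -- the given one at width `w`; hence `w'` precedes `w` among the arguments.
    refine ⟨_, hdiffc.comp (hW.to_comp.pair (hn.to_comp.pair (hw'.to_comp.pair (hw.to_comp.pair
      ((hdetc.comp hpair.to_comp).pair hc.to_comp))))), fun n w w' _ _ _ c h => ?_⟩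
    have hd := SOFA.secondLang_detODDs (hdet n w')
    rw [SOFA.widthCompl, ← hd.2]
    exact hdiff' (2 ^ max w w') n w' w (det (n, w')) c (hle₂ w w') (hle₁ w w') hd.1 h
  · exact ⟨disj, hdisjc, fun n w _ _ c₁ c₂ h₁ h₂ => hdisj n w c₁ c₂ h₁ h₂⟩
  · refine ⟨incl, hinclc, fun n w _ _ c₁ c₂ h₁ h₂ => ?_⟩
    -- Inclusion means that the difference is empty.
    rw [hincl n w c₁ c₂ h₁ h₂, ← Set.sdiff_eq_empty]
    rfl
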